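/- Let $N\ge 1$ and let $q\ge 1$ be the number of spin components of a particle ($q=2$ for electrons, $q=1$ if spin is left out). Let $\mathcal W$ be the set of antisymmetric, $L^2$-normalized $N$-particle wave functions $\psi(\mathbf r_1 s_1,\dots,\mathbf r_N s_N)$, $\mathbf r_j\in\mathbb R^3$, $s_j\in\{1,\dots,q\}$, of class $H^1$ in the positions. For a vector potential $\mathbf A:\mathbb R^3\to\mathbb R^3$ let $$H(0,\mathbf A)=\tfrac12\sum_{j=1}^N\bigl(-\mathrm i\nabla_j+\mathbf A(\mathbf r_j)\bigr)^2+\sum_{i<j}\frac1{|\mathbf r_i-\mathbf r_j|},$$ understood as a quadratic form. A (mixed) state is a density matrix $\Gamma=\sum_i w_i|\psi_i\rangle\langle\psi_i|$ with countably many $\psi_i\in\mathcal W$, $w_i\ge 0$, $\sum_i w_i=1$; we write $\Gamma\mapsto\rho$ if its particle density $\sum_i w_i\,N\sum_{s}\int|\psi_i|^2\,\mathrm d\mathbf r_2\cdots\mathrm d\mathbf r_N$ equals $\rho$ almost everywhere. The Grayce--Harris functional is $$G(\rho,\mathbf A)=\inf_{\Gamma\mapsto\rho}\langle H(0,\mathbf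 A)\rangle_\Gamma .$$ Then for all $N\ge1$ and $q\ge1$ there is a density $\rho$, with $\rho\ge 0$, $\int\rho=N$ and $\sqrt\rho\in H^1(\mathbb R^3)$, such that $G(\rho,\mathbf A)$ is finite for every $\mathbf A\in C_c^\infty(\mathbb R^3;\mathbb R^3)$ and $\mathbf A\mapsto G(\rho,\mathbf A)$ is not convex on $C_c^\infty(\mathbb R^3;\mathbb R^3)$ (hence not convex on any larger set of vector potentials). For the same $\rho$ both assertions hold also for the pure-state functional, in which the infimum is restricted to $\Gamma=|\psi\rangle\langle\psi|$, $\psi\in\mathcal W$. -/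

import Mathlib

open MeasureTheory
open scoped ENNReal NNReal ContDiff

noncomputable section

namespace GrayceHarris

/-- Physical space `ℝ³`. -/
abbrev Space : Type := EuclideanSpace ℝ (Fin 3)

/-- Positions `(r₁, …, r_N)` of `N` particles, with the product Lebesgue measure. -/
abbrev Config (N : ℕ) : Type := Fin N → Space

/-- The unit vector in the `a`-th coordinate direction of `ℝ³`. -/
def axis (a : Fin 3) : Space := EuclideanSpace.single a 1

/-- `g` is the weak (distributional) derivative of `f` in the direction `v`. Only used for
locally integrable `f` and `g`. -/
def HasWeakDeriv {V : Type*} [NormedAddCommGroup V] [NormedSpace ℝ V] [MeasureSpace V]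
    (f g : V → ℂ) (v : V) : Prop :=
  ∀ φ : V → ℝ, ContDiff ℝ ∞ φ → HasCompactSupport φ →
    ∫ x, f x * ((fderiv ℝ φ x v : ℝ) : ℂ) = - ∫ x, g x * ((φ x : ℝ) : ℂ)

/-- A normalized, antisymmetric `N`-electron wave function with `q` spin components, of finite
kinetic energy (class `H¹`). `grad s j a` is the weak derivative of `ψ s` with respect to the
`a`-th coordinate of particle `j`; it is determined almost everywhere by `ψ`. -/
structure WaveFunction (q N : ℕ) where
  /-- The amplitude at the spins `s₁, …, s_N` and the positions `r₁, …, r_N`. -/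
  ψ : (Fin N → Fin q) → Config N → ℂ
  /-- The weak first derivatives. -/
  grad : (Fin N → Fin q) → Fin N → Fin 3 → Config N → ℂ
  memLp_ψ : ∀ s, MemLp (ψ s) 2 volume
  memLp_grad : ∀ s j a, MemLp (grad s j a) 2 volume
  hasWeakDeriv : ∀ s j a, HasWeakDeriv (ψ s) (grad s j a) (Pi.single j (axis a))
  antisymm : ∀ (σ : Equiv.Perm (Fin N)) (s : Fin N → Fin q),
    ∀ᵐ r : Config N, ψ (s ∘ σ) (r ∘ σ) = ((Equiv.Perm.sign σ : ℤ) : ℂ) * ψ s r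
  normalized : ∑ s, ∫⁻ r, ‖ψ s r‖ₑ ^ 2 = 1

namespace WaveFunction

variable {q N : ℕ}

/-- The kinetic energy `½ ∑ⱼ ‖(-i∇ⱼ + A(rⱼ)) ψ‖²`. -/
def kinetic (Ψ : WaveFunction q N) (A : Space → Space) : ℝ≥0∞ :=
  2⁻¹ * ∑ s, ∑ j, ∑ a,
    ∫⁻ r, ‖-Complex.I * Ψ.grad s j a r + ((A (r j) a : ℝ) : ℂ) * Ψ.ψ s r‖ₑ ^ 2

/-- The electron-electron repulsion `⟨ψ, ∑_{i<j} |rᵢ - rⱼ|⁻¹ ψ⟩`. -/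
def repulsion (Ψ : WaveFunction q N) : ℝ≥0∞ :=
  ∑ s, ∫⁻ r, (∑ i, ∑ j ∈ Finset.univ.filter (fun j => i < j),
    ENNReal.ofReal (dist (r i) (r j))⁻¹) * ‖Ψ.ψ s r‖ₑ ^ 2

/-- The expectation value `⟨ψ, H(0, A) ψ⟩`, where
`H(0, A) = ½ ∑ⱼ (-i∇ⱼ + A(rⱼ))² + ∑_{i<j} |rᵢ - rⱼ|⁻¹`, as a nonnegative quadratic form. -/
def energy (Ψ : WaveFunction q N) (A : Space → Space) : ℝ≥0∞ :=
  Ψ.kinetic A + Ψ.repulsion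

/-- The particle density `x ↦ N ∑_s ∫ |ψ_s(x, r₂, …, r_N)|² dr₂ ⋯ dr_N`, here with `N = n + 1`. -/
def density {n : ℕ} (Ψ : WaveFunction q (n + 1)) (x : Space) : ℝ≥0∞ :=
  ((n + 1 : ℕ) : ℝ≥0∞) * ∑ s, ∫⁻ r : Config n, ‖Ψ.ψ s (Fin.cons x r : Config (n + 1))‖ₑ ^ 2

end WaveFunction

/-- A mixed state `Γ = ∑ᵢ wᵢ |ψᵢ⟩⟨ψᵢ|`, given by an ensemble of wave functions. Every such sum is a
density matrix, and by the spectral theorem every density matrix of finite kinetic energy is of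
this form; the density and the energy below depend on the ensemble only through `Γ`. -/
structure MixedState (q N : ℕ) where
  /-- The weights `wᵢ ≥ 0`, of total mass `1`. -/
  weight : ℕ → ℝ≥0
  hasSum_weight : HasSum weight 1
  /-- The wave functions `ψᵢ`. -/
  state : ℕ → WaveFunction q N

namespace MixedState

variable {q N : ℕ}

/-- The expectation value `⟨H(0, A)⟩_Γ = tr (H(0, A) Γ)`. -/
def energy (Γ : MixedState q N) (A : Space → Space) : ℝ≥0∞ :=
  ∑' i, (Γ.weight i : ℝ≥0∞) * (Γ.state i).energy A

/-- The particle density of a mixed state of `n + 1` electrons. -/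
def density {n : ℕ} (Γ : MixedState q (n + 1)) (x : Space) : ℝ≥0∞ :=
  ∑' i, (Γ.weight i : ℝ≥0∞) * (Γ.state i).density x

end MixedState

/-- The Grayce-Harris functional `G(ρ, A) = inf_{Γ ↦ ρ} ⟨H(0, A)⟩_Γ` of `n + 1` electrons, the
infimum being over the mixed states of density `ρ` (it is `⊤` if there are none). -/
def G (q n : ℕ) (ρ : Space → ℝ) (A : Space → Space) : ℝ≥0∞ :=
  ⨅ (Γ : MixedState q (n + 1)) (_ : ∀ᵐ x, Γ.density x = ENNReal.ofReal (ρ x)), Γ.energy A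

/-- The pure-state version of the Grayce-Harris functional, with the infimum over pure states
`Γ = |ψ⟩⟨ψ|` only. -/
def GPure (q n : ℕ) (ρ : Space → ℝ) (A : Space → Space) : ℝ≥0∞ :=
  ⨅ (Ψ : WaveFunction q (n + 1)) (_ : ∀ᵐ x, Ψ.density x = ENNReal.ofReal (ρ x)), Ψ.energy A

/-- `ρ` is a particle density of `N` electrons: `ρ ≥ 0`, `∫ ρ = N` and `√ρ ∈ H¹(ℝ³)`. -/
structure IsDensity (N : ℕ) (ρ : Space → ℝ) : Prop where
  nonneg : ∀ x, 0 ≤ ρ x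
  integrable : Integrable ρ
  integral_eq : ∫ x, ρ x = N
  sqrt_memH1 : ∀ a, ∃ g : Space → ℂ, MemLp g 2 volume ∧
    HasWeakDeriv (fun x => ((√(ρ x) : ℝ) : ℂ)) g (axis a)

/-- The smooth compactly supported vector potentials. Failure of convexity on this vector space
implies failure of convexity on every larger set of vector potentials. -/
def vectorPotentials : Set (Space → Space) :=
  {A | ContDiff ℝ ∞ A ∧ HasCompactSupport A}

end GrayceHarris

end

/-! On the segment from 0 to a potential A that carries one flux quantum through the z-axis, the
functional has a barrier at the midpoint. Let the density vanish near the axis. On its support A =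
∇θ, with θ the azimuth, so multiplying the orbitals by e^{-iθ} removes A, and the kinetic energy
available at 0 is available at A as well (`RealOrbitals.covDeriv_dress`, `fderiv_phase`).

At A/2 the compensating phase e^{-iθ/2} is not single-valued, and every wave function pays for it:
∂_θ + i/2 is bounded below by 1/π (`RotationGenerator.lintegral_weight_le`). Hence each state of
density ρ has energy at least (2π²)⁻¹ ∫ ρ/s², where s is the distance to the axis
(`lintegral_inv_axisDistSq_le_G`). The bound is linear in the state, so it covers mixed states.

It remains to make the Dirichlet energy of √ρ small against ∫ ρ/s². For a fixed bump with a hole of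
radius 2⁻ᵐ around the axis, the Dirichlet energy stays bounded as m grows, since it is scale
invariant in the two transverse dimensions, whereas ∫ ρ/s² grows like m, a logarithmic divergence
(`exists_ringProfile`). For N particles, N translates of the profile along the axis enter a Slater
determinant of one spin. Their supports are disjoint, so energies and densities add, and the
repulsion is made arbitrarily small by spacing the translates widely. The resulting upper bound at 0
and at A lies below the lower bound at A/2, which contradicts convexity. Pure trial states and a
lower bound for all mixed states settle both functionals at once. -/

noncomputable section

namespace GrayceHarris


/-! ### Weak derivatives of smooth functions and integrals over configuration space. -/

section Preliminaries

theorem hasWeakDeriv_fderiv {V : Type*} [NormedAddCommGroup V] [NormedSpace ℝ V] [MeasureSpace V]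
    [BorelSpace V] [FiniteDimensional ℝ V] [(volume : Measure V).IsAddHaarMeasure]
    {f : V → ℂ} (hf : ContDiff ℝ ∞ f) (v : V) :
    HasWeakDeriv f (fun x => fderiv ℝ f x v) v := by
  intro φ hφ hc
  have hφ' : ContDiff ℝ ∞ (fun x => ((φ x : ℝ) : ℂ)) := Complex.ofRealCLM.contDiff.comp hφ
  have hc' : HasCompactSupport (fun x => ((φ x : ℝ) : ℂ)) := 
    hc.comp_left (g := fun t : ℝ => (t : ℂ)) Complex.ofReal_zero
  have key : ∀ x, fderiv ℝ (fun x => ((φ x : ℝ) : ℂ)) x v = ((fderiv ℝ φ x v : ℝ) : ℂ) := by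
    intro x
    have h := Complex.ofRealCLM.hasFDerivAt.comp x
      (hφ.differentiable (by simp) x).hasFDerivAt
    have h2 : fderiv ℝ (fun x => ((φ x : ℝ) : ℂ)) x = _ := h.fderiv
    rw [h2]; simp
  have hfd : Continuous (fun x => fderiv ℝ f x v) :=
    (hf.continuous_fderiv (by simp)).clm_apply continuous_const
  have hφd : Continuous (fun x => fderiv ℝ (fun x => ((φ x : ℝ) : ℂ)) x v) :=
    (hφ'.continuous_fderiv (by simp)).clm_apply continuous_const
  have := integral_mul_fderiv_eq_neg_fderiv_mul_of_integrable (μ := volume) (f := f)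
    (g := fun x => ((φ x : ℝ) : ℂ)) (v := v)
    ((hfd.mul hφ'.continuous).integrable_of_hasCompactSupport hc'.mul_left)
    ((hf.continuous.mul hφd).integrable_of_hasCompactSupport
      (hc'.fderiv_apply (𝕜 := ℝ) v).mul_left)
    ((hf.continuous.mul hφ'.continuous).integrable_of_hasCompactSupport hc'.mul_left)
    (fun x _ => hf.differentiable (by simp) x) (fun x _ => hφ'.differentiable (by simp) x)
  simpa only [key] using this

theorem memLp_fderiv_apply {V : Type*} [NormedAddCommGroup V] [NormedSpace ℝ V] [MeasureSpace V]
    [BorelSpace V] [FiniteDimensional ℝ V] [(volume : Measure V).IsAddHaarMeasure]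
    {f : V → ℂ} (hf : ContDiff ℝ ∞ f) (hc : HasCompactSupport f) (v : V) :
    MemLp (fun x => fderiv ℝ f x v) 2 volume :=
  ((hf.continuous_fderiv (by simp)).clm_apply continuous_const).memLp_of_hasCompactSupport
    (hc.fderiv_apply (𝕜 := ℝ) v)

theorem lintegral_fin_prod_eq_prod {E : Type*} [MeasureSpace E]
    [SigmaFinite (volume : Measure E)] :
    ∀ {n : ℕ} (f : Fin n → E → ℝ≥0∞), (∀ i, Measurable (f i)) →
      ∫⁻ x : Fin n → E, ∏ i, f i (x i) = ∏ i, ∫⁻ x, f i x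
  | 0, f, _ => by simp [volume_pi]
  | n + 1, f, hf => by
    have e := (volume_preserving_piFinSuccAbove (fun _ : Fin (n + 1) => E) 0).symm
    rw [← e.lintegral_comp_emb (MeasurableEquiv.measurableEmbedding _)]
    simp_rw [MeasurableEquiv.piFinSuccAbove_symm_apply, Fin.insertNthEquiv,
      Fin.prod_univ_succ, Fin.insertNth_zero, Equiv.coe_fn_mk, Fin.cons_succ, Fin.cons_zero]
    rw [← lintegral_fin_prod_eq_prod (fun i : Fin n => f i.succ) (fun i => hf _)]
    exact lintegral_prod_mul (hf 0).aemeasurable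
      (Finset.measurable_prod _ fun (i : Fin n) _ => (hf i.succ).comp (measurable_pi_apply i)).aemeasurable

/-- At most one term is nonzero, so there are no cross terms. This is what makes Slater determinants
of orbitals with disjoint supports explicitly computable. -/
theorem enorm_sum_sq_of_disjoint {ι : Type*} [DecidableEq ι] (s : Finset ι) (c : ι → ℂ)
    (h : ∀ i ∈ s, ∀ j ∈ s, i ≠ j → c i = 0 ∨ c j = 0) :
    ‖∑ i ∈ s, c i‖ₑ ^ 2 = ∑ i ∈ s, ‖c i‖ₑ ^ 2 := by
  by_cases h0 : ∀ i ∈ s, c i = 0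
  · rw [Finset.sum_eq_zero h0, Finset.sum_eq_zero]
    · simp
    · intro i hi; simp [h0 i hi]
  · push Not at h0
    obtain ⟨i, hi, hne⟩ := h0
    have hz : ∀ j ∈ s, j ≠ i → c j = 0 := fun j hj hji =>
      (h j hj i hi hji).resolve_right hne
    rw [Finset.sum_eq_single_of_mem i hi hz, Finset.sum_eq_single_of_mem i hi]
    intro j hj hji
    simp [hz j hj hji]

theorem measurePreserving_cons (n : ℕ) :
    MeasurePreserving (fun p : Space × Config n => (Fin.cons p.1 p.2 : Config (n + 1)))
      (volume.prod volume) volume := by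
  have e := (volume_preserving_piFinSuccAbove (fun _ : Fin (n + 1) => Space) 0).symm
  have h : (fun p : Space × Config n => (Fin.cons p.1 p.2 : Config (n + 1))) =
      (MeasurableEquiv.piFinSuccAbove (fun _ : Fin (n + 1) => Space) 0).symm := by
    funext p
    simp [MeasurableEquiv.piFinSuccAbove_symm_apply, Fin.insertNthEquiv]
  exact h ▸ e

theorem lintegral_config_succ {n : ℕ} {f : Config (n + 1) → ℝ≥0∞} (hf : AEMeasurable f) :
    ∫⁻ r, f r = ∫⁻ x : Space, ∫⁻ r : Config n, f (Fin.cons x r) := by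
  have e := measurePreserving_cons n
  have hf' := hf.comp_quasiMeasurePreserving e.quasiMeasurePreserving
  rw [← lintegral_prod (fun p : Space × Config n => f (Fin.cons p.1 p.2)) hf', ← e.map_eq,
    lintegral_map' (by rwa [e.map_eq]) e.measurable.aemeasurable]

theorem lintegral_enorm_sq_lt_top {V : Type*} [MeasurableSpace V] {μ : Measure V} {f : V → ℂ}
    (hf : MemLp f 2 μ) : ∫⁻ x, ‖f x‖ₑ ^ 2 ∂μ < ⊤ := by
  have := lintegral_rpow_enorm_lt_top_of_eLpNorm_lt_top (p := 2) (by simp) (by simp) hf.2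
  simpa using this

end Preliminaries


/-! ### Slater determinants of orbitals with disjoint supports: kinetic energy, repulsion, density.
-/

/-- Normalized smooth orbitals with disjoint compact supports. -/
structure Orbitals (N : ℕ) where
  toFun : Fin N → Space → ℂ
  contDiff : ∀ i, ContDiff ℝ ∞ (toFun i)
  hasCompactSupport : ∀ i, HasCompactSupport (toFun i)
  normalized : ∀ i, ∫⁻ x, ‖toFun i x‖ₑ ^ 2 = 1
  disjoint : ∀ i j, i ≠ j → Disjoint (tsupport (toFun i)) (tsupport (toFun j))

namespace Orbitals

variable {N n q : ℕ} (u : Orbitals N)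

/-- The coefficient of a Slater determinant. -/
def slaterCoeff (N : ℕ) : ℂ := ((√(N.factorial : ℝ) : ℝ) : ℂ)⁻¹

theorem enorm_slaterCoeff_sq (N : ℕ) : ‖slaterCoeff N‖ₑ ^ 2 = ((N.factorial : ℕ) : ℝ≥0∞)⁻¹ := by
  have h : (0 : ℝ) < N.factorial := by exact_mod_cast N.factorial_pos
  rw [slaterCoeff, ← ofReal_norm, ← ENNReal.ofReal_pow (norm_nonneg _), norm_inv,
    Complex.norm_real, Real.norm_of_nonneg (Real.sqrt_nonneg _), inv_pow,
    Real.sq_sqrt h.le, ENNReal.ofReal_inv_of_pos h, ENNReal.ofReal_natCast]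

/-- The Slater determinant of the orbitals. -/
def slater (r : Config N) : ℂ :=
  slaterCoeff N * Matrix.det (Matrix.of fun i j => u.toFun i (r j))

theorem slater_eq (r : Config N) : u.slater r = slaterCoeff N *
    ∑ σ : Equiv.Perm (Fin N), ((Equiv.Perm.sign σ : ℤ) : ℂ) * ∏ k, u.toFun (σ k) (r k) := by
  rw [slater, Matrix.det_apply']
  rfl

theorem slater_comp_perm (τ : Equiv.Perm (Fin N)) (r : Config N) :
    u.slater (r ∘ τ) = ((Equiv.Perm.sign τ : ℤ) : ℂ) * u.slater r := by
  have := Matrix.det_permute' τ (Matrix.of fun i j => u.toFun i (r j))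
  rw [slater, slater, mul_left_comm, ← this]
  rfl

theorem contDiff_slater : ContDiff ℝ ∞ u.slater := by
  have : u.slater = fun r => slaterCoeff N *
    ∑ σ : Equiv.Perm (Fin N), ((Equiv.Perm.sign σ : ℤ) : ℂ) * ∏ k, u.toFun (σ k) (r k) :=
    funext u.slater_eq
  rw [this]
  refine contDiff_const.mul (ContDiff.sum fun σ _ => contDiff_const.mul
    (contDiff_prod fun k _ => (u.contDiff (σ k)).comp ?_))
  exact contDiff_apply ℝ Space k

theorem exists_perm_of_slater_ne_zero {r : Config N} (h : u.slater r ≠ 0) :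
    ∃ σ : Equiv.Perm (Fin N), ∀ k, u.toFun (σ k) (r k) ≠ 0 := by
  by_contra hn
  push Not at hn
  refine h ?_
  rw [slater_eq, Finset.sum_eq_zero, mul_zero]
  intro σ _
  obtain ⟨k, hk⟩ := hn σ
  rw [Finset.prod_eq_zero (Finset.mem_univ k) hk, mul_zero]

theorem hasCompactSupport_slater : HasCompactSupport u.slater := by
  have hK : IsCompact (⋃ i, tsupport (u.toFun i)) :=
    isCompact_iUnion fun i => (u.hasCompactSupport i).isCompact
  refine HasCompactSupport.of_support_subset_isCompact
    (isCompact_univ_pi fun _ : Fin N => hK) ?_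
  intro r hr k _
  obtain ⟨σ, hσ⟩ := u.exists_perm_of_slater_ne_zero hr
  exact Set.mem_iUnion.2 ⟨σ k, subset_tsupport _ (hσ k)⟩

/-- Two different permutations disagree at some slot `k`, where they place `r k` in disjoint
supports, so at most one term survives. The factors `F` are left general so that the result applies
both to the determinant and to its covariant derivatives, in which one factor is replaced. -/
theorem enorm_sum_perm_sq {F : Equiv.Perm (Fin N) → Fin N → Space → ℂ}
    (hF : ∀ σ k x, x ∉ tsupport (u.toFun (σ k)) → F σ k x = 0) (r : Config N) :
    ‖slaterCoeff N * ∑ σ : Equiv.Perm (Fin N),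
      ((Equiv.Perm.sign σ : ℤ) : ℂ) * ∏ k, F σ k (r k)‖ₑ ^ 2 =
    ((N.factorial : ℕ) : ℝ≥0∞)⁻¹ * ∑ σ, ∏ k, ‖F σ k (r k)‖ₑ ^ 2 := by
  rw [enorm_mul, mul_pow, enorm_slaterCoeff_sq, enorm_sum_sq_of_disjoint]
  · congr 1
    refine Finset.sum_congr rfl fun σ _ => ?_
    have hs : ‖((Equiv.Perm.sign σ : ℤ) : ℂ)‖ₑ = 1 := by
      rcases Int.units_eq_one_or (Equiv.Perm.sign σ) with h | h <;> rw [h] <;> simp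
    rw [enorm_mul, hs, one_mul, Finset.prod_pow]
    congr 1
    exact map_prod (⟨⟨fun z : ℂ => ‖z‖ₑ, by simp⟩, enorm_mul⟩ : ℂ →* ℝ≥0∞) _ _
  · intro σ _ τ _ hne
    obtain ⟨k, hk⟩ : ∃ k, σ k ≠ τ k := by
      by_contra hn
      push Not at hn
      exact hne (Equiv.ext hn)
    by_cases hx : r k ∈ tsupport (u.toFun (σ k))
    · right
      rw [Finset.prod_eq_zero (Finset.mem_univ k), mul_zero]
      exact hF τ k _ (Set.disjoint_left.1 (u.disjoint _ _ hk) hx)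
    · left
      rw [Finset.prod_eq_zero (Finset.mem_univ k) (hF σ k _ hx), mul_zero]

theorem lintegral_sum_perm_sq {F : Equiv.Perm (Fin N) → Fin N → Space → ℂ}
    (hF : ∀ σ k x, x ∉ tsupport (u.toFun (σ k)) → F σ k x = 0) (hm : ∀ σ k, Measurable (F σ k)) :
    ∫⁻ r : Config N, ‖slaterCoeff N * ∑ σ : Equiv.Perm (Fin N),
      ((Equiv.Perm.sign σ : ℤ) : ℂ) * ∏ k, F σ k (r k)‖ₑ ^ 2 =
    ((N.factorial : ℕ) : ℝ≥0∞)⁻¹ * ∑ σ, ∏ k, ∫⁻ x, ‖F σ k x‖ₑ ^ 2 := by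
  simp_rw [u.enorm_sum_perm_sq hF]
  have hm2 : ∀ σ : Equiv.Perm (Fin N),
      Measurable (fun r : Config N => ∏ k, ‖F σ k (r k)‖ₑ ^ 2) := fun σ =>
    Finset.measurable_fun_prod _ fun k _ =>
      ((hm σ k).comp (measurable_pi_apply k)).enorm.pow_const 2
  rw [lintegral_const_mul _ (Finset.measurable_fun_sum _ fun σ _ => hm2 σ),
    lintegral_finsetSum _ fun σ _ => hm2 σ]
  congr 1
  refine Finset.sum_congr rfl fun σ _ => ?_
  exact lintegral_fin_prod_eq_prod (fun k x => ‖F σ k x‖ₑ ^ 2)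
    fun k => (hm σ k).enorm.pow_const 2

theorem toFun_eq_zero (i : Fin N) (x : Space) (hx : x ∉ tsupport (u.toFun i)) :
    u.toFun i x = 0 := image_eq_zero_of_notMem_tsupport hx

theorem inv_factorial_mul_cancel (N : ℕ) (c : ℝ≥0∞) :
    ((N.factorial : ℕ) : ℝ≥0∞)⁻¹ * ((N.factorial : ℕ) * c) = c := by
  rw [← mul_assoc, ENNReal.inv_mul_cancel (by exact_mod_cast N.factorial_ne_zero)
    (ENNReal.natCast_ne_top _), one_mul]

/-- For fixed `σ` the sum over the slots `j` already runs over all orbitals; the `N!` permutations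
cancel the normalization. -/
theorem sum_perm_sum (f : Fin N → ℝ≥0∞) :
    ((N.factorial : ℕ) : ℝ≥0∞)⁻¹ * ∑ j, ∑ σ : Equiv.Perm (Fin N), f (σ j) = ∑ i, f i := by
  rw [Finset.sum_comm]
  simp_rw [Equiv.sum_comp]
  rw [Finset.sum_const, Finset.card_univ, Fintype.card_perm, Fintype.card_fin, nsmul_eq_mul,
    inv_factorial_mul_cancel]

theorem lintegral_slater : ∫⁻ r, ‖u.slater r‖ₑ ^ 2 = 1 := by
  simp_rw [slater_eq]
  rw [u.lintegral_sum_perm_sq (F := fun σ k => u.toFun (σ k)) (fun σ k => u.toFun_eq_zero (σ k))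
    fun σ k => (u.contDiff (σ k)).continuous.measurable]
  simp_rw [u.normalized, Finset.prod_const_one]
  rw [Finset.sum_const, Finset.card_univ, Fintype.card_perm, Fintype.card_fin, nsmul_eq_mul,
    inv_factorial_mul_cancel]

/-- The components of `(-i∇ + A) u`. -/
def covDeriv (A : Space → Space) (f : Space → ℂ) (a : Fin 3) (x : Space) : ℂ :=
  -Complex.I * fderiv ℝ f x (axis a) + ((A x a : ℝ) : ℂ) * f x

theorem continuous_covDeriv {A : Space → Space} (hA : Continuous A) {f : Space → ℂ}
    (hf : ContDiff ℝ ∞ f) (a : Fin 3) : Continuous (covDeriv A f a) := by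
  have h1 : Continuous (fun x => fderiv ℝ f x (axis a)) :=
    (hf.continuous_fderiv (by simp)).clm_apply continuous_const
  have h2 : Continuous (fun x => ((A x a : ℝ) : ℂ)) :=
    Complex.continuous_ofReal.comp
      ((EuclideanSpace.proj (𝕜 := ℝ) a).continuous.comp hA)
  exact (continuous_const.mul h1).add (h2.mul hf.continuous)

/-- By the product rule only the factor in slot `j` is differentiated, and the potential term at `r
j` can be absorbed into the same factor. -/
theorem covDeriv_slater (A : Space → Space) (j : Fin N) (a : Fin 3) (r : Config N) :
    -Complex.I * fderiv ℝ u.slater r (Pi.single j (axis a)) +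
      ((A (r j) a : ℝ) : ℂ) * u.slater r = slaterCoeff N * ∑ σ : Equiv.Perm (Fin N),
      ((Equiv.Perm.sign σ : ℤ) : ℂ) * ∏ k,
        (if k = j then covDeriv A (u.toFun (σ k)) a else u.toFun (σ k)) (r k) := by
  have hu : u.slater = fun r => slaterCoeff N *
    ∑ σ : Equiv.Perm (Fin N), ((Equiv.Perm.sign σ : ℤ) : ℂ) * ∏ k, u.toFun (σ k) (r k) :=
    funext u.slater_eq
  have h1 : ∀ σ : Equiv.Perm (Fin N), ∀ k, HasFDerivAt (fun r : Config N => u.toFun (σ k) (r k))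
      ((fderiv ℝ (u.toFun (σ k)) (r k)).comp
        (ContinuousLinearMap.proj (R := ℝ) (φ := fun _ : Fin N => Space) k)) r := fun σ k =>
    HasFDerivAt.comp r ((u.contDiff (σ k)).differentiable (by simp) (r k)).hasFDerivAt
      (ContinuousLinearMap.proj (R := ℝ) (φ := fun _ : Fin N => Space) k).hasFDerivAt
  have h2 : ∀ σ : Equiv.Perm (Fin N), HasFDerivAt
      (fun r : Config N => ∏ k, u.toFun (σ k) (r k)) (∑ k,
        (∏ l ∈ Finset.univ.erase k, u.toFun (σ l) (r l)) •
          ((fderiv ℝ (u.toFun (σ k)) (r k)).comp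
            (ContinuousLinearMap.proj (R := ℝ) (φ := fun _ : Fin N => Space) k))) r := fun σ => by
    have := HasFDerivAt.finsetProd (u := Finset.univ) (x := r) fun (k : Fin N) _ => h1 σ k
    exact this
  have h3 := fun σ : Equiv.Perm (Fin N) => (h2 σ).const_mul ((Equiv.Perm.sign σ : ℤ) : ℂ)
  have h4 := (HasFDerivAt.fun_sum (u := Finset.univ)
    fun (σ : Equiv.Perm (Fin N)) _ => h3 σ).const_mul (slaterCoeff N)
  rw [← hu] at h4
  rw [h4.fderiv, u.slater_eq]
  simp only [_root_.smul_apply, _root_.sum_apply, smul_eq_mul,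
    ContinuousLinearMap.comp_apply, ContinuousLinearMap.proj_apply]
  rw [mul_left_comm, mul_left_comm _ (slaterCoeff N), ← mul_add, Finset.mul_sum, Finset.mul_sum,
    ← Finset.sum_add_distrib]
  congr 1
  refine Finset.sum_congr rfl fun σ _ => ?_
  rw [mul_left_comm, mul_left_comm _ (((Equiv.Perm.sign σ : ℤ) : ℂ)), ← mul_add]
  congr 1
  rw [Finset.sum_eq_single_of_mem j (Finset.mem_univ j),
    ← Finset.mul_prod_erase _ _ (Finset.mem_univ j), ← Finset.mul_prod_erase _ _ (Finset.mem_univ j)]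
  · have : ∏ k ∈ Finset.univ.erase j,
        (if k = j then covDeriv A (u.toFun (σ k)) a else u.toFun (σ k)) (r k) =
        ∏ k ∈ Finset.univ.erase j, u.toFun (σ k) (r k) :=
      Finset.prod_congr rfl fun k hk => by rw [if_neg (Finset.ne_of_mem_erase hk)]
    rw [this, if_pos rfl, covDeriv, Pi.single_eq_same]
    ring
  · intro k _ hk
    rw [Pi.single_eq_of_ne hk]
    simp

theorem lintegral_covDeriv_slater {A : Space → Space} (hA : Continuous A) (j : Fin N)
    (a : Fin 3) :
    ∫⁻ r, ‖-Complex.I * fderiv ℝ u.slater r (Pi.single j (axis a)) +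
      ((A (r j) a : ℝ) : ℂ) * u.slater r‖ₑ ^ 2 =
    ((N.factorial : ℕ) : ℝ≥0∞)⁻¹ * ∑ σ : Equiv.Perm (Fin N),
      ∫⁻ x, ‖covDeriv A (u.toFun (σ j)) a x‖ₑ ^ 2 := by
  simp_rw [u.covDeriv_slater A j a]
  rw [u.lintegral_sum_perm_sq
    (F := fun σ k => if k = j then covDeriv A (u.toFun (σ k)) a else u.toFun (σ k))]
  · congr 1
    refine Finset.sum_congr rfl fun σ _ => ?_
    rw [← Finset.mul_prod_erase _ _ (Finset.mem_univ j), Finset.prod_eq_one, if_pos rfl, mul_one]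
    intro k hk
    rw [if_neg (Finset.ne_of_mem_erase hk), u.normalized]
  · intro σ k x hx
    split_ifs
    · rw [covDeriv, u.toFun_eq_zero _ _ hx, fderiv_of_notMem_tsupport ℝ hx]
      simp
    · exact u.toFun_eq_zero _ _ hx
  · intro σ k
    split_ifs
    · exact (continuous_covDeriv hA (u.contDiff _) a).measurable
    · exact (u.contDiff _).continuous.measurable

/-- The Slater determinant of the orbitals, with all spins equal to `s₀`. -/
def waveFunction (s₀ : Fin q) : WaveFunction q N where
  ψ s r := if s = (fun _ => s₀) then u.slater r else 0
  grad s j a r := if s = (fun _ => s₀) then fderiv ℝ u.slater r (Pi.single j (axis a)) else 0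
  memLp_ψ s := by
    by_cases hs : s = fun _ => s₀
    · simpa [hs] using u.contDiff_slater.continuous.memLp_of_hasCompactSupport
        u.hasCompactSupport_slater
    · simp [hs]
  memLp_grad s j a := by
    by_cases hs : s = fun _ => s₀
    · simpa [hs] using memLp_fderiv_apply u.contDiff_slater u.hasCompactSupport_slater _
    · simp [hs]
  hasWeakDeriv s j a := by
    by_cases hs : s = fun _ => s₀
    · simpa [hs] using hasWeakDeriv_fderiv u.contDiff_slater _
    · intro φ _ _
      simp [hs]
  antisymm σ s := by
    refine Filter.Eventually.of_forall fun r => ?_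
    have : s ∘ σ = (fun _ => s₀) ↔ s = fun _ => s₀ := by
      constructor
      · intro h
        funext k
        simpa using congrFun h (σ.symm k)
      · rintro rfl
        rfl
    by_cases hs : s = fun _ => s₀
    · rw [if_pos (this.2 hs), if_pos hs, slater_comp_perm]
    · rw [if_neg (this.not.2 hs), if_neg hs, mul_zero]
  normalized := by
    rw [Finset.sum_eq_single_of_mem (fun _ => s₀) (Finset.mem_univ _)]
    · simpa using u.lintegral_slater
    · intro s _ hs
      simp [hs]

theorem kinetic_waveFunction (s₀ : Fin q) {A : Space → Space} (hA : Continuous A) :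
    (u.waveFunction s₀).kinetic A =
      2⁻¹ * ∑ i, ∑ a, ∫⁻ x, ‖covDeriv A (u.toFun i) a x‖ₑ ^ 2 := by
  rw [WaveFunction.kinetic, Finset.sum_eq_single_of_mem (fun _ => s₀) (Finset.mem_univ _)]
  · simp only [waveFunction, if_true]
    simp_rw [u.lintegral_covDeriv_slater hA, ← Finset.mul_sum]
    congr 1
    rw [← sum_perm_sum fun i => ∑ a, ∫⁻ x, ‖covDeriv A (u.toFun i) a x‖ₑ ^ 2]
    congr 1
    refine Finset.sum_congr rfl fun j _ => ?_
    exact Finset.sum_comm (f := fun (a : Fin 3) (σ : Equiv.Perm (Fin N)) =>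
      ∫⁻ x, ‖covDeriv A (u.toFun (σ j)) a x‖ₑ ^ 2)
  · intro s _ hs
    simp [waveFunction, hs]

/-- Where the determinant is nonzero, the particles occupy supports of distinct orbitals, so each
pair contributes at most `d⁻¹`. The pairs are generously counted as `N * N`. -/
theorem repulsion_waveFunction_le (s₀ : Fin q) {d : ℝ} (hd : 0 < d)
    (h : ∀ i j, i ≠ j → ∀ x, u.toFun i x ≠ 0 → ∀ y, u.toFun j y ≠ 0 → d ≤ dist x y) :
    (u.waveFunction s₀).repulsion ≤ (N : ℝ≥0∞) * (N * ENNReal.ofReal d⁻¹) := by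
  rw [WaveFunction.repulsion, Finset.sum_eq_single_of_mem (fun _ => s₀) (Finset.mem_univ _)]
  · simp only [waveFunction, if_true]
    calc _ ≤ ∫⁻ r, ((N : ℝ≥0∞) * (N * ENNReal.ofReal d⁻¹)) * ‖u.slater r‖ₑ ^ 2 := by
          refine lintegral_mono fun r => ?_
          by_cases hr : u.slater r = 0
          · simp [hr]
          obtain ⟨σ, hσ⟩ := u.exists_perm_of_slater_ne_zero hr
          refine mul_le_mul' ?_ le_rfl
          calc _ ≤ ∑ _i : Fin N, ∑ _j : Fin N, ENNReal.ofReal d⁻¹ := by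
                refine Finset.sum_le_sum fun i _ => ?_
                refine le_trans (Finset.sum_le_sum fun j hj => ?_)
                  (Finset.sum_le_sum_of_subset (Finset.subset_univ _))
                have hij : i ≠ j := (Finset.mem_filter.1 hj).2.ne
                exact ENNReal.ofReal_le_ofReal (inv_anti₀ hd
                  (h _ _ (σ.injective.ne hij) _ (hσ i) _ (hσ j)))
            _ = _ := by simp
      _ = _ := by
          rw [lintegral_const_mul _ (u.contDiff_slater.continuous.measurable.enorm.pow_const 2),
            u.lintegral_slater, mul_one]
  · intro s _ hs
    simp [waveFunction, hs]

theorem density_waveFunction (u : Orbitals (n + 1)) (s₀ : Fin q) (x : Space) :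
    (u.waveFunction s₀).density x = ∑ i, ‖u.toFun i x‖ₑ ^ 2 := by
  have h1 : ∫⁻ r : Config n, ‖u.slater (Fin.cons x r : Config (n + 1))‖ₑ ^ 2 =
      (((n + 1).factorial : ℕ) : ℝ≥0∞)⁻¹ *
        ∑ σ : Equiv.Perm (Fin (n + 1)), ‖u.toFun (σ 0) x‖ₑ ^ 2 := by
    have hp : ∀ r : Config n, ‖u.slater (Fin.cons x r : Config (n + 1))‖ₑ ^ 2 =
        (((n + 1).factorial : ℕ) : ℝ≥0∞)⁻¹ * ∑ σ : Equiv.Perm (Fin (n + 1)),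
          ‖u.toFun (σ 0) x‖ₑ ^ 2 * ∏ k : Fin n, ‖u.toFun (σ k.succ) (r k)‖ₑ ^ 2 := by
      intro r
      rw [slater_eq, u.enorm_sum_perm_sq (F := fun σ k => u.toFun (σ k))
        (fun σ k => u.toFun_eq_zero (σ k))]
      simp_rw [Fin.prod_univ_succ, Fin.cons_zero, Fin.cons_succ]
    simp_rw [hp]
    have hm2 : ∀ σ : Equiv.Perm (Fin (n + 1)),
        Measurable (fun r : Config n => ∏ k : Fin n, ‖u.toFun (σ k.succ) (r k)‖ₑ ^ 2) := fun σ =>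
      Finset.measurable_fun_prod _ fun k _ =>
        ((u.contDiff _).continuous.measurable.comp (measurable_pi_apply k)).enorm.pow_const 2
    rw [lintegral_const_mul _ (Finset.measurable_fun_sum _ fun σ _ => (hm2 σ).const_mul _),
      lintegral_finsetSum _ fun σ _ => (hm2 σ).const_mul _]
    congr 1
    refine Finset.sum_congr rfl fun σ _ => ?_
    rw [lintegral_const_mul _ (hm2 σ), lintegral_fin_prod_eq_prod
      (fun k x => ‖u.toFun (σ k.succ) x‖ₑ ^ 2)
      fun k => (u.contDiff _).continuous.measurable.enorm.pow_const 2]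
    simp [u.normalized]
  rw [WaveFunction.density, Finset.sum_eq_single_of_mem (fun _ => s₀) (Finset.mem_univ _)]
  · simp only [waveFunction, if_true]
    rw [h1, ← sum_perm_sum, mul_left_comm]
    congr 1
    -- Reindexing by the transposition of 0 and `j` shows that the slot is irrelevant, so the
    -- prefactor `n + 1` of the density amounts to a sum over slots.
    have h2 : ∀ j : Fin (n + 1), ∑ σ : Equiv.Perm (Fin (n + 1)), ‖u.toFun (σ j) x‖ₑ ^ 2 =
        ∑ σ : Equiv.Perm (Fin (n + 1)), ‖u.toFun (σ 0) x‖ₑ ^ 2 := by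
      intro j
      rw [← Equiv.sum_comp (Equiv.mulRight (Equiv.swap 0 j))
        (fun σ : Equiv.Perm (Fin (n + 1)) => ‖u.toFun (σ 0) x‖ₑ ^ 2)]
      simp
    simp_rw [h2]
    simp
  · intro s _ hs
    simp [waveFunction, hs]

end Orbitals


/-! ### The angular Hardy inequality at half a flux quantum, for an abstract rotation flow. -/

section Rotation

variable {V : Type*} [NormedAddCommGroup V] [NormedSpace ℝ V]

/-- A linear flow of rotations: `gen` is the infinitesimal generator and `proj` the projection onto
the plane of rotation. -/
structure RotationGenerator (V : Type*) [NormedAddCommGroup V] [NormedSpace ℝ V]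
    [MeasureSpace V] where
  gen : V →L[ℝ] V
  proj : V →L[ℝ] V
  gen_gen : ∀ x, gen (gen x) = -proj x
  gen_proj : ∀ x, gen (proj x) = gen x
  proj_gen : ∀ x, proj (gen x) = gen x
  proj_proj : ∀ x, proj (proj x) = proj x
  norm_eq : ∀ (t : ℝ) (x : V), ‖x + (Real.cos t - 1) • proj x + Real.sin t • gen x‖ = ‖x‖
  measurePreserving : ∀ t : ℝ,
    MeasurePreserving (fun x : V => x + (Real.cos t - 1) • proj x + Real.sin t • gen x)

namespace RotationGenerator

variable [MeasureSpace V] (J : RotationGenerator V)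

/-- The rotation by the angle `t`. -/
def rot (t : ℝ) : V →L[ℝ] V :=
  ContinuousLinearMap.id ℝ V + (Real.cos t - 1) • J.proj + Real.sin t • J.gen

theorem rot_apply (t : ℝ) (x : V) :
    J.rot t x = x + (Real.cos t - 1) • J.proj x + Real.sin t • J.gen x := rfl

theorem norm_rot (t : ℝ) (x : V) : ‖J.rot t x‖ = ‖x‖ := J.norm_eq t x

theorem measurePreserving_rot (t : ℝ) : MeasurePreserving (J.rot t) := J.measurePreserving t

theorem rot_zero (x : V) : J.rot 0 x = x := by simp [rot_apply]

theorem rot_neg_two_pi (x : V) : J.rot (-(2 * Real.pi)) x = x := by simp [rot_apply]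

theorem rot_neg_rot (t : ℝ) (x : V) : J.rot (-t) (J.rot t x) = x := by
  simp only [rot_apply, map_add, map_smul, J.gen_gen, J.gen_proj, J.proj_gen, J.proj_proj,
    Real.cos_neg, Real.sin_neg]
  have h : Real.sin t * Real.sin t = 1 - Real.cos t * Real.cos t := by
    nlinarith [Real.sin_sq_add_cos_sq t]
  have : x + (Real.cos t - 1) • J.proj x + -Real.sin t • J.gen x +
      (Real.cos t - 1) •
        (J.proj x + (Real.cos t - 1) • J.proj x + -Real.sin t • J.gen x) +
      Real.sin t • (J.gen x + (Real.cos t - 1) • J.gen x + -Real.sin t • -J.proj x) =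
      x + ((Real.sin t * Real.sin t) - (1 - Real.cos t * Real.cos t)) • J.proj x := by
    module
  rw [this, h]
  simp

theorem continuous_rot : Continuous (fun p : ℝ × V => J.rot p.1 p.2) := by
  simp only [rot_apply]
  have := J.proj.continuous
  have := J.gen.continuous
  fun_prop

theorem hasDerivAt_rot_neg (t : ℝ) (x : V) :
    HasDerivAt (fun t => J.rot (-t) x) (-J.rot (-t) (J.gen x)) t := by
  have h1 : HasDerivAt (fun t : ℝ => (Real.cos t - 1) • J.proj x) ((-Real.sin t) • J.proj x) t :=
    ((Real.hasDerivAt_cos t).sub_const 1).smul_const _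
  have h2 : HasDerivAt (fun t : ℝ => (Real.sin t) • J.gen x) ((Real.cos t) • J.gen x) t :=
    (Real.hasDerivAt_sin t).smul_const _
  have h3 := ((hasDerivAt_const t x).add h1).sub h2
  have e : (fun t => J.rot (-t) x) =
      fun t : ℝ => x + (Real.cos t - 1) • J.proj x - Real.sin t • J.gen x := by
    funext t
    simp [rot_apply, sub_eq_add_neg]
  rw [e]
  refine h3.congr_deriv ?_
  simp only [rot_apply, J.gen_gen, J.proj_gen, Real.cos_neg, Real.sin_neg]
  module

variable {J} {u h : V → ℂ}

/-- The integral kernel of the representation formula for functions with a half flux. -/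
def kernel (J : RotationGenerator V) (φ : V → ℝ) (t : ℝ) (r : V) : ℂ :=
  Complex.exp (t / 2 * Complex.I) * (Complex.I / 2 * (φ (J.rot (-t) r) : ℝ)
    - ((fderiv ℝ φ (J.rot (-t) r) (J.rot (-t) (J.gen r)) : ℝ) : ℂ))

theorem continuous_kernel {φ : V → ℝ} (hφ : ContDiff ℝ ∞ φ) :
    Continuous (fun p : ℝ × V => J.kernel φ p.1 p.2) := by
  have h1 : Continuous (fun p : ℝ × V => J.rot (-p.1) p.2) :=
    J.continuous_rot.comp (f := fun p : ℝ × V => (-p.1, p.2))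
      (continuous_fst.neg.prodMk continuous_snd)
  have h2 : Continuous (fun p : ℝ × V => J.rot (-p.1) (J.gen p.2)) :=
    J.continuous_rot.comp (f := fun p : ℝ × V => (-p.1, J.gen p.2))
      (continuous_fst.neg.prodMk (J.gen.continuous.comp continuous_snd))
  have h3 : Continuous (fun p : ℝ × V => fderiv ℝ φ (J.rot (-p.1) p.2)
      (J.rot (-p.1) (J.gen p.2))) :=
    ((hφ.continuous_fderiv (by simp)).comp h1).clm_apply h2
  have h4 : Continuous (fun p : ℝ × V => φ (J.rot (-p.1) p.2)) := hφ.continuous.comp h1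
  unfold kernel
  fun_prop

/-- The kernel is the `t`-derivative of e^{it/2} φ(R₋ₜ r). After a full turn the point returns but
the phase has become -1, so the boundary terms add up to -2φ instead of cancelling. This
antiperiodicity is the entire effect of the half flux. -/
theorem integral_kernel {φ : V → ℝ} (hφ : ContDiff ℝ ∞ φ) (r : V) :
    ∫ t in (0 : ℝ)..(2 * Real.pi), J.kernel φ t r = -2 * (φ r : ℂ) := by
  have hd : ∀ t : ℝ, HasDerivAt
      (fun t : ℝ => Complex.exp (t / 2 * Complex.I) * ((φ (J.rot (-t) r) : ℝ) : ℂ))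
      (J.kernel φ t r) t := by
    intro t
    have h1 : HasDerivAt (fun t : ℝ => Complex.exp (t / 2 * Complex.I))
        (Complex.exp (t / 2 * Complex.I) * (1 / 2 * Complex.I)) t := by
      have : HasDerivAt (fun t : ℝ => ((t : ℂ) / 2 * Complex.I)) (1 / 2 * Complex.I) t :=
        ((Complex.ofRealCLM.hasDerivAt (x := t)).div_const 2).mul_const _
      exact this.cexp
    have h2 : HasDerivAt (fun t : ℝ => φ (J.rot (-t) r))
        (fderiv ℝ φ (J.rot (-t) r) (-J.rot (-t) (J.gen r))) t :=
      (hφ.differentiable (by simp) (J.rot (-t) r)).hasFDerivAt.comp_hasDerivAt t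
        (J.hasDerivAt_rot_neg t r)
    have h3 : HasDerivAt (fun t : ℝ => ((φ (J.rot (-t) r) : ℝ) : ℂ)) _ t := h2.ofReal_comp
    refine (h1.mul h3).congr_deriv ?_
    simp only [kernel, map_neg, Complex.ofReal_neg]
    ring
  rw [intervalIntegral.integral_eq_sub_of_hasDerivAt (fun t _ => hd t)]
  · simp only [rot_neg_two_pi, neg_zero, rot_zero]
    have : Complex.exp (((2 * Real.pi : ℝ) : ℂ) / 2 * Complex.I) = -1 := by
      rw [← Complex.exp_pi_mul_I]; congr 1; push_cast; ring
    rw [this]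
    simp
    ring
  · exact ((continuous_kernel hφ).comp
      (continuous_id.prodMk continuous_const)).intervalIntegrable _ _

theorem kernel_eq_zero {φ : V → ℝ} {R : ℝ} (hR : tsupport φ ⊆ Metric.closedBall 0 R) (t : ℝ)
    {r : V} (hr : R < ‖r‖) : J.kernel φ t r = 0 := by
  have : J.rot (-t) r ∉ tsupport φ := fun hm => by
    have := hR hm
    simp [norm_rot] at this
    linarith
  rw [kernel, image_eq_zero_of_notMem_tsupport this, fderiv_of_notMem_tsupport ℝ this]
  simp

theorem indicator_closedBall_rot (R t : ℝ) (r : V) :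
    (Metric.closedBall (0 : V) R).indicator h (J.rot t r) =
      (Metric.closedBall (0 : V) R).indicator (fun r => h (J.rot t r)) r := by
  simp [Set.indicator, norm_rot]

variable [BorelSpace V] [FiniteDimensional ℝ V]

/-- The rotated function φ ∘ R₋ₜ is again a test function. Testing the weak angular derivative
against it turns the kernel into `h`, and the invariance of the measure then moves the rotation from
`φ` to `h`. -/
theorem integral_mul_kernel (hu : LocallyIntegrable u) {g : V → ℂ} (hg : LocallyIntegrable g)
    (hh : ∀ r, h r = g r + Complex.I / 2 * u r)
    (hw : ∀ φ : V → ℝ, ContDiff ℝ ∞ φ → HasCompactSupport φ →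
      ∫ r, u r * ((fderiv ℝ φ r (J.gen r) : ℝ) : ℂ) = - ∫ r, g r * ((φ r : ℝ) : ℂ))
    {φ : V → ℝ} (hφ : ContDiff ℝ ∞ φ) (hc : HasCompactSupport φ) (t : ℝ) :
    ∫ r, u r * J.kernel φ t r =
      ∫ r, Complex.exp (t / 2 * Complex.I) * h (J.rot t r) * ((φ r : ℝ) : ℂ) := by
  set ψ : V → ℝ := fun r => φ (J.rot (-t) r) with hψ
  have hψs : ContDiff ℝ ∞ ψ := hφ.comp (J.rot (-t)).contDiff
  have hψc : HasCompactSupport ψ := by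
    obtain ⟨R, hR⟩ := hc.isCompact.isBounded.subset_closedBall 0
    refine HasCompactSupport.of_support_subset_isCompact (isCompact_closedBall (0 : V) R) ?_
    intro r hr
    have := hR (subset_tsupport φ (show J.rot (-t) r ∈ Function.support φ from hr))
    simpa [norm_rot] using this
  have hψd : ∀ r v, fderiv ℝ ψ r v = fderiv ℝ φ (J.rot (-t) r) (J.rot (-t) v) := by
    intro r v
    have := ((hφ.differentiable (by simp) (J.rot (-t) r)).hasFDerivAt.comp r
      (J.rot (-t)).hasFDerivAt).fderiv
    have h2 : fderiv ℝ ψ r = _ := this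
    rw [h2]; rfl
  have hψ' : ContDiff ℝ ∞ (fun x => ((ψ x : ℝ) : ℂ)) := Complex.ofRealCLM.contDiff.comp hψs
  have hψc' : HasCompactSupport (fun x => ((ψ x : ℝ) : ℂ)) :=
    hψc.comp_left (g := fun t : ℝ => (t : ℂ)) Complex.ofReal_zero
  have hdc : Continuous (fun r => ((fderiv ℝ ψ r (J.gen r) : ℝ) : ℂ)) :=
    Complex.continuous_ofReal.comp
      ((hψs.continuous_fderiv (by simp)).clm_apply J.gen.continuous)
  have hds : HasCompactSupport (fun r => ((fderiv ℝ ψ r (J.gen r) : ℝ) : ℂ)) := by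
    refine HasCompactSupport.of_support_subset_isCompact hψc.isCompact ?_
    intro r hr
    by_contra hn
    exact hr (by simp [fderiv_of_notMem_tsupport ℝ hn])
  have i1 : Integrable (fun r => u r * ((ψ r : ℝ) : ℂ)) :=
    hu.integrable_smul_right_of_hasCompactSupport hψ'.continuous hψc'
  have i2 : Integrable (fun r => u r * ((fderiv ℝ ψ r (J.gen r) : ℝ) : ℂ)) :=
    hu.integrable_smul_right_of_hasCompactSupport hdc hds
  have i3 : Integrable (fun r => g r * ((ψ r : ℝ) : ℂ)) :=
    hg.integrable_smul_right_of_hasCompactSupport hψ'.continuous hψc'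
  have e1 : ∀ r, u r * J.kernel φ t r = Complex.exp (t / 2 * Complex.I) *
      (Complex.I / 2 * (u r * ((ψ r : ℝ) : ℂ)) -
        u r * ((fderiv ℝ ψ r (J.gen r) : ℝ) : ℂ)) := by
    intro r
    rw [kernel, hψd]
    ring
  have e2 : ∀ r, Complex.exp (t / 2 * Complex.I) * h r * ((ψ r : ℝ) : ℂ) =
      Complex.exp (t / 2 * Complex.I) *
      (Complex.I / 2 * (u r * ((ψ r : ℝ) : ℂ)) + g r * ((ψ r : ℝ) : ℂ)) := by
    intro r
    rw [hh]
    ring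
  have e3 : ∫ r, Complex.exp (t / 2 * Complex.I) * h (J.rot t r) * ((φ r : ℝ) : ℂ) =
      ∫ r, Complex.exp (t / 2 * Complex.I) * h r * ((ψ r : ℝ) : ℂ) := by
    have hemb : MeasurableEmbedding (J.rot t) := by
      refine (J.rot t).continuous.measurableEmbedding fun x y hxy => ?_
      rw [← J.rot_neg_rot t x, hxy, J.rot_neg_rot]
    have := (J.measurePreserving_rot t).integral_comp hemb
      (fun r => Complex.exp (t / 2 * Complex.I) * h r * ((ψ r : ℝ) : ℂ))
    rw [← this]
    simp only [hψ, rot_neg_rot]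
  rw [e3]
  simp_rw [e1, e2]
  rw [integral_const_mul, integral_const_mul, integral_sub (i1.const_mul _) i2,
    integral_add (i1.const_mul _) i3, hw ψ hψs hψc, sub_neg_eq_add]

theorem integrable_phase_mul {μ : Measure (ℝ × V)} {F : ℝ × V → ℂ} (hF : Integrable F μ) :
    Integrable (fun p : ℝ × V => Complex.exp ((p.1 : ℝ) / 2 * Complex.I) * F p) μ := by
  refine hF.bdd_mul (c := 1) (Continuous.aestronglyMeasurable (by fun_prop)) ?_
  refine Filter.Eventually.of_forall fun p => ?_
  have : ((p.1 : ℝ) : ℂ) / 2 * Complex.I = ((p.1 / 2 : ℝ) : ℂ) * Complex.I := by push_cast; rfl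
  rw [this, Complex.norm_exp_ofReal_mul_I]

variable [(volume : Measure V).IsAddHaarMeasure]

theorem measurePreserving_skew (μ : Measure ℝ) [SFinite μ] :
    MeasurePreserving (fun p : ℝ × V => (p.1, J.rot p.1 p.2)) (μ.prod volume)
      (μ.prod volume) :=
  (MeasurePreserving.id μ).skew_product (g := fun t r => J.rot t r) J.continuous_rot.measurable
    (Filter.Eventually.of_forall fun t => (J.measurePreserving_rot t).map_eq)

/-- Truncation to a centred ball commutes with the rotations, so local integrability suffices for
Fubini arguments. -/
theorem integrable_comp_rot_indicator (hl : LocallyIntegrable h) (R : ℝ) :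
    Integrable (fun p : ℝ × V => (Metric.closedBall (0 : V) R).indicator h (J.rot p.1 p.2))
      ((volume.restrict (Set.Ioc 0 (2 * Real.pi))).prod volume) := by
  have h1 : Integrable ((Metric.closedBall (0 : V) R).indicator h) :=
    (integrable_indicator_iff Metric.isClosed_closedBall.measurableSet).2
      (hl.integrableOn_isCompact (isCompact_closedBall _ _))
  have h2 : Integrable (fun p : ℝ × V => (Metric.closedBall (0 : V) R).indicator h p.2)
      ((volume.restrict (Set.Ioc 0 (2 * Real.pi))).prod volume) := h1.comp_snd _
  exact (J.measurePreserving_skew (volume.restrict (Set.Ioc 0 (2 * Real.pi)))).integrable_comp_of_integrable h2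

/-- The average of `h` over the rotations, with the phase of a half flux. -/
def average (J : RotationGenerator V) (h : V → ℂ) (r : V) : ℂ :=
  ∫ t in Set.Ioc 0 (2 * Real.pi), Complex.exp ((t : ℝ) / 2 * Complex.I) * h (J.rot t r)

theorem locallyIntegrable_average (hl : LocallyIntegrable h) :
    LocallyIntegrable (J.average h) := by
  rw [locallyIntegrable_iff]
  intro K hK
  obtain ⟨R, hR⟩ := hK.isBounded.subset_closedBall 0
  refine IntegrableOn.mono_set ?_ hR
  rw [← integrable_indicator_iff Metric.isClosed_closedBall.measurableSet]
  have := (integrable_phase_mul (J.integrable_comp_rot_indicator hl R)).integral_prod_right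
  refine this.congr (Filter.Eventually.of_forall fun r => ?_)
  simp only [indicator_closedBall_rot]
  by_cases hr : r ∈ Metric.closedBall (0 : V) R
  · simp only [Set.indicator_of_mem hr, average]
  · simp only [Set.indicator_of_notMem hr, mul_zero, integral_zero]

/-- For smooth `u` this integrates d/dt [e^{it/2} u(Rₜ r)] = e^{it/2} h(Rₜ r) over one turn. Since
`u` has only a weak angular derivative, the identity is tested against smooth `φ`, with the flow
acting on `φ`. -/
theorem ae_eq_average (hu : LocallyIntegrable u) {g : V → ℂ} (hg : LocallyIntegrable g)
    (hh : ∀ r, h r = g r + Complex.I / 2 * u r)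
    (hw : ∀ φ : V → ℝ, ContDiff ℝ ∞ φ → HasCompactSupport φ →
      ∫ r, u r * ((fderiv ℝ φ r (J.gen r) : ℝ) : ℂ) = - ∫ r, g r * ((φ r : ℝ) : ℂ)) :
    ∀ᵐ r, -2 * u r = J.average h r := by
  have hl : LocallyIntegrable h := by
    have : h = g + (Complex.I / 2) • u := by
      funext r; simp [hh]
    rw [this]
    exact hg.add (hu.smul _)
  refine ae_eq_of_integral_contDiff_smul_eq (hu.smul (-2 : ℂ)) (locallyIntegrable_average hl) ?_
  intro φ hφ hc
  obtain ⟨R, hR⟩ := hc.isCompact.isBounded.subset_closedBall 0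
  have hpi : (0 : ℝ) ≤ 2 * Real.pi := by positivity
  set μ : Measure ℝ := volume.restrict (Set.Ioc 0 (2 * Real.pi)) with hμ
  have s1 : ∀ r, φ r • (-2 * u r) = ∫ t, u r * J.kernel φ t r ∂μ := by
    intro r
    rw [integral_const_mul, hμ, ← intervalIntegral.integral_of_le hpi, integral_kernel hφ,
      Complex.real_smul]
    ring
  -- The kernel vanishes for `r` outside the ball containing the support of `φ`, and is bounded on
  -- that ball times [0, 2π].
  have hi1 : Integrable (fun p : V × ℝ => u p.1 * J.kernel φ p.2 p.1) (volume.prod μ) := by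
    have hcont : Continuous (fun p : V × ℝ => J.kernel φ p.2 p.1) :=
      (continuous_kernel (J := J) hφ).comp continuous_swap
    obtain ⟨C, hC⟩ := ((isCompact_closedBall (0 : V) R).prod
      (isCompact_Icc (a := (0 : ℝ)) (b := 2 * Real.pi))).exists_bound_of_continuousOn
      hcont.continuousOn
    have hub : Integrable ((Metric.closedBall (0 : V) R).indicator u) :=
      (integrable_indicator_iff Metric.isClosed_closedBall.measurableSet).2
        (hu.integrableOn_isCompact (isCompact_closedBall _ _))
    have h2 : Integrable (fun p : V × ℝ => (Metric.closedBall (0 : V) R).indicator u p.1)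
      (volume.prod μ) := hub.comp_fst _
    refine (h2.norm.const_mul C).mono' ?_ ?_
    · exact (hu.aestronglyMeasurable.comp_fst).mul hcont.aestronglyMeasurable
    · have hae : ∀ᵐ p : V × ℝ ∂(volume.prod μ), p.2 ∈ Set.Ioc 0 (2 * Real.pi) :=
        Measure.quasiMeasurePreserving_snd.ae (ae_restrict_mem measurableSet_Ioc)
      filter_upwards [hae] with p hp
      by_cases hr : p.1 ∈ Metric.closedBall (0 : V) R
      · rw [Set.indicator_of_mem hr, norm_mul, mul_comm]
        exact mul_le_mul_of_nonneg_right (hC p ⟨hr, ⟨hp.1.le, hp.2⟩⟩) (norm_nonneg _)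
      · rw [Set.indicator_of_notMem hr, kernel_eq_zero hR]
        · simp
        · simpa using hr
  have hi2 : Integrable (fun p : ℝ × V => Complex.exp ((p.1 : ℝ) / 2 * Complex.I) *
      h (J.rot p.1 p.2) * ((φ p.2 : ℝ) : ℂ)) (μ.prod volume) := by
    obtain ⟨C, hC⟩ := hc.exists_bound_of_continuous hφ.continuous
    have h3 := (integrable_phase_mul (J.integrable_comp_rot_indicator hl R)).mul_bdd (c := C)
      (g := fun p : ℝ × V => ((φ p.2 : ℝ) : ℂ))
      ((Complex.continuous_ofReal.comp (hφ.continuous.comp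
        continuous_snd)).aestronglyMeasurable)
      (Filter.Eventually.of_forall fun p => by simpa using hC p.2)
    refine h3.congr (Filter.Eventually.of_forall fun p => ?_)
    simp only [indicator_closedBall_rot]
    by_cases hr : p.2 ∈ Metric.closedBall (0 : V) R
    · simp only [Set.indicator_of_mem hr]
    · have : φ p.2 = 0 := image_eq_zero_of_notMem_tsupport fun hm => hr (hR hm)
      simp [this]
  calc ∫ r, φ r • ((-2 : ℂ) • u) r = ∫ r, ∫ t, u r * J.kernel φ t r ∂μ :=
        integral_congr_ae (Filter.Eventually.of_forall s1)
    _ = ∫ t, (∫ r : V, u r * J.kernel φ t r) ∂μ := integral_integral_swap hi1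
    _ = ∫ t, (∫ r : V, Complex.exp ((t : ℝ) / 2 * Complex.I) * h (J.rot t r) * ((φ r : ℝ) : ℂ)) ∂μ := by
        simp_rw [integral_mul_kernel hu hg hh hw hφ hc]
    _ = ∫ r : V, ∫ t, Complex.exp ((t : ℝ) / 2 * Complex.I) * h (J.rot t r) * ((φ r : ℝ) : ℂ) ∂μ :=
        integral_integral_swap hi2
    _ = ∫ r, φ r • J.average h r := by
        refine integral_congr_ae (Filter.Eventually.of_forall fun r => ?_)
        simp only [average, integral_mul_const, Complex.real_smul]
        rw [mul_comm]

theorem sq_lintegral_le {α : Type*} [MeasurableSpace α] {μ : Measure α} {f : α → ℝ≥0∞}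
    (hf : AEMeasurable f μ) :
    (∫⁻ x, f x ∂μ) ^ 2 ≤ μ Set.univ * ∫⁻ x, f x ^ 2 ∂μ := by
  have := ENNReal.lintegral_mul_le_Lp_mul_Lq μ Real.HolderConjugate.two_two hf
    (aemeasurable_const (b := (1 : ℝ≥0∞)))
  simp only [Pi.mul_apply, mul_one, lintegral_const, ENNReal.rpow_ofNat, one_pow, one_mul] at this
  calc (∫⁻ x, f x ∂μ) ^ 2 ≤ ((∫⁻ x, f x ^ 2 ∂μ) ^ (1 / 2 : ℝ) * μ Set.univ ^ (1 / 2 : ℝ)) ^ 2 := by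
        gcongr
    _ = μ Set.univ * ∫⁻ x, f x ^ 2 ∂μ := by
        rw [mul_pow, ← ENNReal.rpow_natCast, ← ENNReal.rpow_natCast, ← ENNReal.rpow_mul,
          ← ENNReal.rpow_mul, mul_comm]
        simp

/-- Cauchy–Schwarz over the turn gives 4|u|² ≤ 2π ∫ |h(Rₜ r)|² dt. Integration against the invariant
weight removes the rotation and yields another 2π, so the constant is (2π)²/4 = π². It need not be
sharp for the application. -/
theorem lintegral_weight_le_aux (hm : StronglyMeasurable h) {w : V → ℝ≥0∞} (hwm : Measurable w)
    (hwr : ∀ t r, w (J.rot t r) = w r) (ha : ∀ᵐ r, -2 * u r = J.average h r) :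
    ∫⁻ r, w r * ‖u r‖ₑ ^ 2 ≤ ENNReal.ofReal (Real.pi ^ 2) * ∫⁻ r, w r * ‖h r‖ₑ ^ 2 := by
  set μ : Measure ℝ := volume.restrict (Set.Ioc 0 (2 * Real.pi)) with hμ
  have hμu : μ Set.univ = ENNReal.ofReal (2 * Real.pi) := by simp [hμ]
  have hjm : Measurable (fun p : ℝ × V => ‖h (J.rot p.1 p.2)‖ₑ) :=
    (hm.measurable.comp J.continuous_rot.measurable).enorm
  have hpt : ∀ᵐ r, 4 * ‖u r‖ₑ ^ 2 ≤
      ENNReal.ofReal (2 * Real.pi) * ∫⁻ t, ‖h (J.rot t r)‖ₑ ^ 2 ∂μ := by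
    filter_upwards [ha] with r hr
    have h1 : ‖(-2 : ℂ) * u r‖ₑ ≤ ∫⁻ t, ‖h (J.rot t r)‖ₑ ∂μ := by
      rw [hr, average]
      refine (enorm_integral_le_lintegral_enorm _).trans (le_of_eq ?_)
      refine lintegral_congr fun t => ?_
      have : ((t : ℝ) : ℂ) / 2 * Complex.I = ((t / 2 : ℝ) : ℂ) * Complex.I := by push_cast; rfl
      rw [enorm_mul, this, ← ofReal_norm, Complex.norm_exp_ofReal_mul_I]
      simp
    have h2 : ‖(-2 : ℂ) * u r‖ₑ ^ 2 = 4 * ‖u r‖ₑ ^ 2 := by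
      rw [enorm_mul, mul_pow]
      congr 1
      rw [← ofReal_norm, ← ENNReal.ofReal_pow (norm_nonneg _)]
      norm_num
    rw [← h2, ← hμu]
    refine (pow_le_pow_left' h1 2).trans (sq_lintegral_le ?_)
    exact (hjm.comp measurable_prodMk_right).aemeasurable
  have hswap : ∫⁻ r, w r * ∫⁻ t, ‖h (J.rot t r)‖ₑ ^ 2 ∂μ =
      ENNReal.ofReal (2 * Real.pi) * ∫⁻ r, w r * ‖h r‖ₑ ^ 2 := by
    have hF : Measurable (fun r => w r * ‖h r‖ₑ ^ 2) := hwm.mul (hm.measurable.enorm.pow_const 2)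
    calc ∫⁻ r, w r * ∫⁻ t, ‖h (J.rot t r)‖ₑ ^ 2 ∂μ
        = ∫⁻ r, ∫⁻ t, w (J.rot t r) * ‖h (J.rot t r)‖ₑ ^ 2 ∂μ := by
          refine lintegral_congr fun r => ?_
          simp_rw [hwr]
          rw [lintegral_const_mul]
          exact (hjm.comp measurable_prodMk_right).pow_const 2
      _ = ∫⁻ t, (∫⁻ r : V, w (J.rot t r) * ‖h (J.rot t r)‖ₑ ^ 2) ∂μ := by
          rw [lintegral_lintegral_swap]
          exact (hF.comp (J.continuous_rot.measurable.comp measurable_swap)).aemeasurable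
      _ = ∫⁻ t, (∫⁻ r : V, w r * ‖h r‖ₑ ^ 2) ∂μ := by
          refine lintegral_congr fun t => ?_
          exact (J.measurePreserving_rot t).lintegral_comp hF
      _ = _ := by rw [lintegral_const, hμu, mul_comm]
  have hfin : 4 * ∫⁻ r, w r * ‖u r‖ₑ ^ 2 ≤
      4 * (ENNReal.ofReal (Real.pi ^ 2) * ∫⁻ r, w r * ‖h r‖ₑ ^ 2) := by
    calc 4 * ∫⁻ r, w r * ‖u r‖ₑ ^ 2 = ∫⁻ r, w r * (4 * ‖u r‖ₑ ^ 2) := by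
          rw [← lintegral_const_mul' _ _ (by simp)]
          refine lintegral_congr fun r => ?_
          ring
      _ ≤ ∫⁻ r, w r * (ENNReal.ofReal (2 * Real.pi) * ∫⁻ t, ‖h (J.rot t r)‖ₑ ^ 2 ∂μ) := by
          refine lintegral_mono_ae ?_
          filter_upwards [hpt] with r hr
          gcongr
      _ = ENNReal.ofReal (2 * Real.pi) * ∫⁻ r, w r * ∫⁻ t, ‖h (J.rot t r)‖ₑ ^ 2 ∂μ := by
          rw [← lintegral_const_mul' _ _ ENNReal.ofReal_ne_top]
          refine lintegral_congr fun r => ?_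
          ring
      _ = _ := by
          rw [hswap, ← mul_assoc, ← mul_assoc, ← ENNReal.ofReal_mul (by positivity)]
          congr 1
          rw [show (4 : ℝ≥0∞) = ENNReal.ofReal 4 by simp, ← ENNReal.ofReal_mul (by norm_num)]
          congr 1
          ring
  exact (ENNReal.mul_le_mul_iff_right (by simp) (by simp)).1 hfin

/-- Angular Hardy inequality for functions with a half flux: the operator `∂_θ + i/2` is bounded
below by `1/π`, in every rotation invariant weight. -/
theorem lintegral_weight_le (hu : LocallyIntegrable u) {g : V → ℂ} (hg : LocallyIntegrable g)
    (hw : ∀ φ : V → ℝ, ContDiff ℝ ∞ φ → HasCompactSupport φ →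
      ∫ r, u r * ((fderiv ℝ φ r (J.gen r) : ℝ) : ℂ) = - ∫ r, g r * ((φ r : ℝ) : ℂ))
    {w : V → ℝ≥0∞} (hwm : Measurable w) (hwr : ∀ t r, w (J.rot t r) = w r) :
    ∫⁻ r, w r * ‖u r‖ₑ ^ 2 ≤
      ENNReal.ofReal (Real.pi ^ 2) * ∫⁻ r, w r * ‖g r + Complex.I / 2 * u r‖ₑ ^ 2 := by
  -- The composition with rotations requires an everywhere measurable integrand, hence the passage
  -- to measurable representatives.
  set u' := hu.aestronglyMeasurable.mk u
  set g' := hg.aestronglyMeasurable.mk g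
  have hu' : u =ᵐ[volume] u' := hu.aestronglyMeasurable.ae_eq_mk
  have hg' : g =ᵐ[volume] g' := hg.aestronglyMeasurable.ae_eq_mk
  have hav := ae_eq_average (J := J) (u := u') (g := g')
    (h := fun r => g' r + Complex.I / 2 * u' r) (hu.congr hu') (hg.congr hg') (fun r => rfl)
    (by
      intro φ hφ hc
      have := hw φ hφ hc
      rw [integral_congr_ae (f := fun r => u r * ((fderiv ℝ φ r (J.gen r) : ℝ) : ℂ))
        (g := fun r => u' r * ((fderiv ℝ φ r (J.gen r) : ℝ) : ℂ))
        (by filter_upwards [hu'] with r hr; rw [hr]),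
        integral_congr_ae (f := fun r => g r * ((φ r : ℝ) : ℂ))
        (g := fun r => g' r * ((φ r : ℝ) : ℂ))
        (by filter_upwards [hg'] with r hr; rw [hr])] at this
      exact this)
  have := lintegral_weight_le_aux (J := J) (u := u') (h := fun r => g' r + Complex.I / 2 * u' r)
    (hg.aestronglyMeasurable.stronglyMeasurable_mk.add
      (hu.aestronglyMeasurable.stronglyMeasurable_mk.const_mul _)) hwm hwr hav
  rw [lintegral_congr_ae (g := fun r => w r * ‖u' r‖ₑ ^ 2)
    (by filter_upwards [hu'] with r hr; rw [hr]),
    lintegral_congr_ae (f := fun r => w r * ‖g r + Complex.I / 2 * u r‖ₑ ^ 2)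
    (g := fun r => w r * ‖g' r + Complex.I / 2 * u' r‖ₑ ^ 2)
    (by filter_upwards [hu', hg'] with r hr hr'; rw [hr, hr'])]
  exact this

end RotationGenerator

end Rotation


/-! ### Rotations of space about the z-axis and of a single particle in configuration space. -/

section RotationInstances

/-- The squared distance of a point to the `z`-axis. -/
def axisDistSq (x : Space) : ℝ := x 0 ^ 2 + x 1 ^ 2

theorem contDiff_coord (a : Fin 3) : ContDiff ℝ ∞ (fun x : Space => x a) :=
  (EuclideanSpace.proj (𝕜 := ℝ) a).contDiff

theorem contDiff_axisDistSq : ContDiff ℝ ∞ axisDistSq :=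
  ((contDiff_coord 0).pow 2).add ((contDiff_coord 1).pow 2)

/-- The generator of the rotations about the `z`-axis. -/
def axisGen : Space →L[ℝ] Space :=
  (EuclideanSpace.proj (𝕜 := ℝ) (0 : Fin 3)).smulRight (axis 1) -
    (EuclideanSpace.proj (𝕜 := ℝ) (1 : Fin 3)).smulRight (axis 0)

/-- The projection onto the plane orthogonal to the `z`-axis. -/
def axisProj : Space →L[ℝ] Space :=
  (EuclideanSpace.proj (𝕜 := ℝ) (0 : Fin 3)).smulRight (axis 0) +
    (EuclideanSpace.proj (𝕜 := ℝ) (1 : Fin 3)).smulRight (axis 1)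

theorem axisGen_apply (x : Space) : axisGen x = x 0 • axis 1 - x 1 • axis 0 := rfl

theorem axisProj_apply (x : Space) : axisProj x = x 0 • axis 0 + x 1 • axis 1 := rfl

theorem norm_axisRot (t : ℝ) (x : Space) :
    ‖x + (Real.cos t - 1) • axisProj x + Real.sin t • axisGen x‖ = ‖x‖ := by
  rw [EuclideanSpace.norm_eq, EuclideanSpace.norm_eq]
  congr 1
  simp [Fin.sum_univ_three, axisGen_apply, axisProj_apply, axis]
  linear_combination (x 0 ^ 2 + x 1 ^ 2) * Real.sin_sq_add_cos_sq t

/-- The rotations of space about the `z`-axis. -/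
def axisRotation : RotationGenerator Space where
  gen := axisGen
  proj := axisProj
  gen_gen x := by
    ext a; fin_cases a <;> simp [axisGen_apply, axisProj_apply, axis]
  gen_proj x := by
    ext a; fin_cases a <;> simp [axisGen_apply, axisProj_apply, axis]
  proj_gen x := by
    ext a; fin_cases a <;> simp [axisGen_apply, axisProj_apply, axis]
  proj_proj x := by
    ext a; fin_cases a <;> simp [axisProj_apply, axis]
  norm_eq := norm_axisRot
  measurePreserving t := by
    let L : Space →ₗᵢ[ℝ] Space :=
      ⟨((ContinuousLinearMap.id ℝ Space + (Real.cos t - 1) • axisProj + Real.sin t • axisGen :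
        Space →L[ℝ] Space) : Space →ₗ[ℝ] Space), norm_axisRot t⟩
    exact (L.toLinearIsometryEquiv rfl).measurePreserving

theorem axisDistSq_rot (t : ℝ) (x : Space) :
    axisDistSq (axisRotation.rot t x) = axisDistSq x := by
  simp [RotationGenerator.rot_apply, axisRotation, axisDistSq, axisGen_apply, axisProj_apply, axis]
  linear_combination (x 0 ^ 2 + x 1 ^ 2) * Real.sin_sq_add_cos_sq t

namespace RotationGenerator

variable {E : Type*} [NormedAddCommGroup E] [NormedSpace ℝ E] [MeasureSpace E]

theorem pi_single_rot (J : RotationGenerator E) {N : ℕ} (j : Fin N) (t : ℝ) (r : Fin N → E) :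
    r + (Real.cos t - 1) • (Pi.single j (J.proj (r j)) : Fin N → E) +
      Real.sin t • (Pi.single j (J.gen (r j)) : Fin N → E) =
      fun i => (if i = j then (J.rot t : E → E) else id) (r i) := by
  funext i
  by_cases h : i = j
  · subst h; simp [rot_apply]
  · simp [h]

variable [SigmaFinite (volume : Measure E)]

/-- The rotation of the `j`-th particle. -/
def particle (J : RotationGenerator E) {N : ℕ} (j : Fin N) : RotationGenerator (Fin N → E) where
  gen := (ContinuousLinearMap.single ℝ (fun _ => E) j).comp
    (J.gen.comp (ContinuousLinearMap.proj (R := ℝ) (φ := fun _ : Fin N => E) j))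
  proj := (ContinuousLinearMap.single ℝ (fun _ => E) j).comp
    (J.proj.comp (ContinuousLinearMap.proj (R := ℝ) (φ := fun _ : Fin N => E) j))
  gen_gen r := by simp [J.gen_gen, Pi.single_neg]
  gen_proj r := by simp [J.gen_proj]
  proj_gen r := by simp [J.proj_gen]
  proj_proj r := by simp [J.proj_proj]
  norm_eq t r := by
    simp only [ContinuousLinearMap.comp_apply, ContinuousLinearMap.proj_apply,
      ContinuousLinearMap.single_apply]
    rw [pi_single_rot, Pi.norm_def, Pi.norm_def]
    -- The norm on configurations is the supremum over particles, so it is preserved because each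
    -- particle's norm is.
    congr 2
    funext i
    by_cases h : i = j
    · simp only [h, if_true]
      exact NNReal.eq (J.norm_rot t _)
    · simp [h]
  measurePreserving t := by
    simp only [ContinuousLinearMap.comp_apply, ContinuousLinearMap.proj_apply,
      ContinuousLinearMap.single_apply, pi_single_rot]
    refine volume_preserving_pi (f := fun i => (if i = j then (J.rot t : E → E) else id)) ?_
    intro i
    by_cases h : i = j
    · simpa [h] using J.measurePreserving_rot t
    · simpa [h] using MeasurePreserving.id _

theorem particle_gen (J : RotationGenerator E) {N : ℕ} (j : Fin N) (r : Fin N → E) :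
    (J.particle j).gen r = Pi.single j (J.gen (r j)) := rfl

theorem particle_rot_self (J : RotationGenerator E) {N : ℕ} (j : Fin N) (t : ℝ) (r : Fin N → E) :
    (J.particle j).rot t r j = J.rot t (r j) := by
  have : (J.particle j).rot t r = _ := J.pi_single_rot j t r
  rw [this]
  simp

end RotationGenerator

end RotationInstances

/-! ### Lower bound for the energy of an arbitrary state in a half flux. -/

namespace WaveFunction

variable {q N n : ℕ}

/-- The weak derivative along x ∂_y - y ∂_x comes from the test functions xφ and yφ. Each coordinate
is constant in the direction of differentiation, so the product rule produces no extra term. -/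
theorem integral_mul_fderiv_rotation (Ψ : WaveFunction q N) (s : Fin N → Fin q) (j : Fin N)
    {φ : Config N → ℝ} (hφ : ContDiff ℝ ∞ φ) (hc : HasCompactSupport φ) :
    ∫ r, Ψ.ψ s r * ((fderiv ℝ φ r ((axisRotation.particle j).gen r) : ℝ) : ℂ) =
      - ∫ r, (((r j 0 : ℝ) : ℂ) * Ψ.grad s j 1 r - ((r j 1 : ℝ) : ℂ) * Ψ.grad s j 0 r) *
        ((φ r : ℝ) : ℂ) := by
  have hcoord : ∀ a : Fin 3, ContDiff ℝ ∞ (fun r : Config N => r j a) := fun a =>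
    (contDiff_coord a).comp
      (ContinuousLinearMap.proj (R := ℝ) (φ := fun _ : Fin N => Space) j).contDiff
  have hu : LocallyIntegrable (Ψ.ψ s) := (Ψ.memLp_ψ s).locallyIntegrable (by norm_num)
  have hg : ∀ a, LocallyIntegrable (Ψ.grad s j a) :=
    fun a => (Ψ.memLp_grad s j a).locallyIntegrable (by norm_num)
  have key : ∀ a b : Fin 3, a ≠ b →
      (Integrable fun r => Ψ.ψ s r *
        ((r j a * fderiv ℝ φ r (Pi.single j (axis b)) : ℝ) : ℂ)) ∧
      (Integrable fun r => Ψ.grad s j b r * ((r j a * φ r : ℝ) : ℂ)) ∧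
      ∫ r, Ψ.ψ s r * ((r j a * fderiv ℝ φ r (Pi.single j (axis b)) : ℝ) : ℂ) =
        - ∫ r, Ψ.grad s j b r * ((r j a * φ r : ℝ) : ℂ) := by
    intro a b hab
    have hd : ∀ r, fderiv ℝ (fun r : Config N => r j a * φ r) r (Pi.single j (axis b)) =
        r j a * fderiv ℝ φ r (Pi.single j (axis b)) := by
      intro r
      have hl : HasFDerivAt (fun r : Config N => r j a)
          ((EuclideanSpace.proj (𝕜 := ℝ) a).comp
            (ContinuousLinearMap.proj (R := ℝ) (φ := fun _ : Fin N => Space) j)) r :=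
        ((EuclideanSpace.proj (𝕜 := ℝ) a).comp
            (ContinuousLinearMap.proj (R := ℝ) (φ := fun _ : Fin N => Space) j)).hasFDerivAt
      have := (hl.mul (hφ.differentiable (by simp) r).hasFDerivAt).fderiv
      have h2 : fderiv ℝ (fun r : Config N => r j a * φ r) r = _ := this
      rw [h2]
      simp [axis, hab]
    have hcs : HasCompactSupport (fun r : Config N => r j a * φ r) := hc.mul_left
    have hws := Ψ.hasWeakDeriv s j b (fun r => r j a * φ r) ((hcoord a).mul hφ) hcs
    simp only [hd] at hws
    refine ⟨?_, ?_, hws⟩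
    · refine hu.integrable_smul_right_of_hasCompactSupport (Complex.continuous_ofReal.comp
        ((hcoord a).continuous.mul ((hφ.continuous_fderiv (by simp)).clm_apply
          continuous_const))) ?_
      exact ((hc.fderiv_apply (𝕜 := ℝ) (Pi.single j (axis b))).mul_left
        (f := fun r : Config N => r j a)).comp_left (g := fun t : ℝ => (t : ℂ)) Complex.ofReal_zero
    · exact (hg b).integrable_smul_right_of_hasCompactSupport (Complex.continuous_ofReal.comp
        ((hcoord a).continuous.mul hφ.continuous))
        (hcs.comp_left (g := fun t : ℝ => (t : ℂ)) Complex.ofReal_zero)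
  obtain ⟨i1, i2, e1⟩ := key 0 1 (by decide)
  obtain ⟨i3, i4, e2⟩ := key 1 0 (by decide)
  calc ∫ r, Ψ.ψ s r * ((fderiv ℝ φ r ((axisRotation.particle j).gen r) : ℝ) : ℂ)
      = ∫ r, (Ψ.ψ s r * ((r j 0 * fderiv ℝ φ r (Pi.single j (axis 1)) : ℝ) : ℂ) -
        Ψ.ψ s r * ((r j 1 * fderiv ℝ φ r (Pi.single j (axis 0)) : ℝ) : ℂ)) := by
        refine integral_congr_ae (Filter.Eventually.of_forall fun r => ?_)
        have : (axisRotation.particle j).gen r =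
            r j 0 • (Pi.single j (axis 1) : Config N) -
              r j 1 • (Pi.single j (axis 0) : Config N) := by
          rw [RotationGenerator.particle_gen, ← Pi.single_smul, ← Pi.single_smul, ← Pi.single_sub]
          rfl
        simp only [this, map_sub, map_smul, smul_eq_mul]
        push_cast
        ring
    _ = - ∫ r, (Ψ.grad s j 1 r * ((r j 0 * φ r : ℝ) : ℂ) -
          Ψ.grad s j 0 r * ((r j 1 * φ r : ℝ) : ℂ)) := by
        rw [integral_sub i1 i3, integral_sub i2 i4, e1, e2]
        ring
    _ = _ := by
        congr 1
        refine integral_congr_ae (Filter.Eventually.of_forall fun r => ?_)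
        push_cast
        ring

theorem aemeasurable_enorm_sq (Ψ : WaveFunction q N) (s : Fin N → Fin q) :
    AEMeasurable (fun r => ‖Ψ.ψ s r‖ₑ ^ 2) :=
  (Ψ.memLp_ψ s).1.enorm.pow_const 2

/-- Exchanging two particles changes ψ only by a sign. It also exchanges their spins, so the
equality holds only after summation over spins. -/
theorem lintegral_weight_perm (Ψ : WaveFunction q N) (W : Space → ℝ≥0∞) (i j : Fin N) :
    ∑ s, ∫⁻ r, W (r j) * ‖Ψ.ψ s r‖ₑ ^ 2 = ∑ s, ∫⁻ r, W (r i) * ‖Ψ.ψ s r‖ₑ ^ 2 := by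
  set σ : Equiv.Perm (Fin N) := Equiv.swap i j
  have hσ : σ.symm = σ := Equiv.symm_swap i j
  have e := volume_measurePreserving_piCongrLeft (fun _ : Fin N => Space) σ
  have he : ∀ r : Config N, MeasurableEquiv.piCongrLeft (fun _ : Fin N => Space) σ r = r ∘ σ := by
    intro r
    funext k
    have := Equiv.piCongrLeft_apply_apply (fun _ : Fin N => Space) σ r (σ.symm k)
    rw [Equiv.apply_symm_apply, hσ] at this
    exact this
  have h1 : ∀ s, ∫⁻ r, W (r j) * ‖Ψ.ψ s r‖ₑ ^ 2 = ∫⁻ r, W (r i) * ‖Ψ.ψ (s ∘ σ) r‖ₑ ^ 2 := by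
    intro s
    rw [← e.lintegral_comp_emb (MeasurableEquiv.measurableEmbedding _)
      (fun r => W (r i) * ‖Ψ.ψ (s ∘ σ) r‖ₑ ^ 2)]
    refine lintegral_congr_ae ?_
    filter_upwards [Ψ.antisymm σ s] with r hr
    rw [he, hr]
    have : (r ∘ σ) i = r j := by simp [σ]
    rw [this, enorm_mul]
    have hs : ‖((Equiv.Perm.sign σ : ℤ) : ℂ)‖ₑ = 1 := by
      rcases Int.units_eq_one_or (Equiv.Perm.sign σ) with h | h <;> rw [h] <;> simp
    rw [hs, one_mul]
  simp_rw [h1]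
  exact Equiv.sum_comp (Equiv.arrowCongr σ.symm (Equiv.refl (Fin q)))
    (fun s => ∫⁻ r, W (r i) * ‖Ψ.ψ s r‖ₑ ^ 2)

theorem aemeasurable_lintegral_cons (Ψ : WaveFunction q (n + 1)) (s : Fin (n + 1) → Fin q) :
    AEMeasurable
      (fun x : Space => ∫⁻ r : Config n, ‖Ψ.ψ s (Fin.cons x r : Config (n + 1))‖ₑ ^ 2) :=
  ((Ψ.aemeasurable_enorm_sq s).comp_quasiMeasurePreserving
    (measurePreserving_cons n).quasiMeasurePreserving).lintegral_prod_right'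

theorem aemeasurable_density (Ψ : WaveFunction q (n + 1)) : AEMeasurable Ψ.density :=
  (Finset.aemeasurable_fun_sum _ fun s _ => Ψ.aemeasurable_lintegral_cons s).const_mul _

/-- All particles contribute equally; the density singles out particle 0 and compensates by the
factor `n + 1`. -/
theorem lintegral_weight_density (Ψ : WaveFunction q (n + 1)) {W : Space → ℝ≥0∞}
    (hW : Measurable W) :
    ∫⁻ x, W x * Ψ.density x = ∑ j, ∑ s, ∫⁻ r, W (r j) * ‖Ψ.ψ s r‖ₑ ^ 2 := by
  have hm : ∀ s, AEMeasurable (fun r : Config (n + 1) => W (r 0) * ‖Ψ.ψ s r‖ₑ ^ 2) := fun s =>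
    (hW.comp (measurable_pi_apply 0)).aemeasurable.mul (Ψ.aemeasurable_enorm_sq s)
  have h0 : ∀ j, ∑ s, ∫⁻ r, W (r j) * ‖Ψ.ψ s r‖ₑ ^ 2 = ∑ s, ∫⁻ r, W (r 0) * ‖Ψ.ψ s r‖ₑ ^ 2 :=
    fun j => Ψ.lintegral_weight_perm W 0 j
  simp_rw [h0]
  rw [Finset.sum_const, Finset.card_univ, Fintype.card_fin, nsmul_eq_mul]
  have h1 : ∀ s, ∫⁻ r, W (r 0) * ‖Ψ.ψ s r‖ₑ ^ 2 =
      ∫⁻ x, W x * ∫⁻ r : Config n, ‖Ψ.ψ s (Fin.cons x r : Config (n + 1))‖ₑ ^ 2 := by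
    intro s
    rw [lintegral_config_succ (hm s)]
    simp only [Fin.cons_zero]
    have hae : ∀ᵐ x : Space, AEMeasurable
        (fun r : Config n => ‖Ψ.ψ s (Fin.cons x r : Config (n + 1))‖ₑ ^ 2) := by
      have hq := (Ψ.aemeasurable_enorm_sq s).comp_quasiMeasurePreserving
        (measurePreserving_cons n).quasiMeasurePreserving
      have h2 := Measure.ae_ae_of_ae_prod hq.ae_eq_mk
      filter_upwards [h2] with x hx
      exact (hq.measurable_mk.comp measurable_prodMk_left).aemeasurable.congr
        (Filter.EventuallyEq.symm hx)
    refine lintegral_congr_ae ?_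
    filter_upwards [hae] with x hx
    rw [lintegral_const_mul'' _ hx]
  simp_rw [h1]
  have hm3 : ∀ s, AEMeasurable (fun x : Space =>
      W x * ∫⁻ r : Config n, ‖Ψ.ψ s (Fin.cons x r : Config (n + 1))‖ₑ ^ 2) := fun s =>
    hW.aemeasurable.mul (Ψ.aemeasurable_lintegral_cons s)
  rw [← lintegral_finsetSum' _ (fun s _ => hm3 s),
    ← lintegral_const_mul'' _ (Finset.aemeasurable_fun_sum _ fun s _ => hm3 s)]
  refine lintegral_congr fun x => ?_
  rw [density, ← Finset.mul_sum]
  ring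

/-- This confines every particle to the region carrying the density, so the potential matters only
there. The weight used is the indicator of the complement of `S`. -/
theorem ae_eq_zero_of_density (Ψ : WaveFunction q (n + 1)) {S : Set Space} (hS : MeasurableSet S)
    (h : ∀ᵐ x, x ∉ S → Ψ.density x = 0) (s : Fin (n + 1) → Fin q) (j : Fin (n + 1)) :
    ∀ᵐ r : Config (n + 1), r j ∉ S → Ψ.ψ s r = 0 := by
  have hW : Measurable (Sᶜ.indicator (fun _ => 1) : Space → ℝ≥0∞) :=
    measurable_const.indicator hS.compl
  have h1 := Ψ.lintegral_weight_density hW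
  have h2 : ∫⁻ x, (Sᶜ.indicator (fun _ => 1) : Space → ℝ≥0∞) x * Ψ.density x = 0 := by
    rw [lintegral_eq_zero_of_ae_eq_zero]
    filter_upwards [h] with x hx
    by_cases hxs : x ∈ S
    · simp [hxs]
    · simp [hx hxs]
  rw [h2] at h1
  have h3 := (Finset.sum_eq_zero_iff.1 ((Finset.sum_eq_zero_iff.1 h1.symm) j
    (Finset.mem_univ _))) s (Finset.mem_univ _)
  have hm : AEMeasurable (fun r : Config (n + 1) =>
      (Sᶜ.indicator (fun _ => 1) : Space → ℝ≥0∞) (r j) * ‖Ψ.ψ s r‖ₑ ^ 2) :=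
    (hW.comp (measurable_pi_apply j)).aemeasurable.mul (Ψ.aemeasurable_enorm_sq s)
  filter_upwards [(lintegral_eq_zero_iff' hm).1 h3] with r hr hrs
  simpa [hrs] using hr

theorem locallyIntegrable_continuous_mul {g c : Config N → ℂ} (hg : LocallyIntegrable g)
    (hc : Continuous c) : LocallyIntegrable (fun r => c r * g r) := by
  rw [locallyIntegrable_iff]
  intro K hK
  exact (hg.integrableOn_isCompact hK).continuousOn_mul hc.continuousOn hK

/-- With D = -i∇ + A one has i(x D₁ - y D₀) = x ∂_y - y ∂_x + i(x A₁ - y A₀), whose last term is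
i/2; Cauchy–Schwarz does the rest. Where `u` vanishes, the potential drops out. `D2` makes room for
the z-component of the kinetic energy. -/
theorem enorm_rotation_sq_le {g0 g1 u : ℂ} {x y a b : ℝ} (D2 : ℝ≥0∞)
    (h : u = 0 ∨ x * b - y * a = 1 / 2) :
    ‖(x : ℂ) * g1 - y * g0 + Complex.I / 2 * u‖ₑ ^ 2 ≤ ENNReal.ofReal (x ^ 2 + y ^ 2) *
      (‖-Complex.I * g0 + a * u‖ₑ ^ 2 + ‖-Complex.I * g1 + b * u‖ₑ ^ 2 + D2) := by
  set d0 := -Complex.I * g0 + a * u with hd0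
  set d1 := -Complex.I * g1 + b * u with hd1
  have e1 : (x : ℂ) * g1 - y * g0 + Complex.I / 2 * u = Complex.I * (x * d1 - y * d0) := by
    rcases h with h | h
    · rw [hd0, hd1, h]
      linear_combination ((x : ℂ) * g1 - y * g0) * Complex.I_sq
    · have h' : (x : ℂ) * b - y * a = 1 / 2 := by
        have := congrArg (fun t : ℝ => (t : ℂ)) h
        push_cast at this
        exact this
      rw [hd0, hd1]
      linear_combination ((x : ℂ) * g1 - y * g0) * Complex.I_sq - Complex.I * u * h'
  have e2 : ‖Complex.I * (x * d1 - y * d0)‖ ^ 2 ≤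
      (x ^ 2 + y ^ 2) * (‖d0‖ ^ 2 + ‖d1‖ ^ 2) := by
    rw [norm_mul, Complex.norm_I, one_mul]
    have h1 : ‖(x : ℂ) * d1 - y * d0‖ ≤ |x| * ‖d1‖ + |y| * ‖d0‖ := by
      refine (norm_sub_le _ _).trans ?_
      simp
    have h2 : ‖(x : ℂ) * d1 - y * d0‖ ^ 2 ≤ (|x| * ‖d1‖ + |y| * ‖d0‖) ^ 2 := by gcongr
    refine h2.trans ?_
    rw [← sq_abs x, ← sq_abs y]
    nlinarith [sq_nonneg (|x| * ‖d0‖ - |y| * ‖d1‖)]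
  have e3 : ∀ z : ℂ, ‖z‖ₑ ^ 2 = ENNReal.ofReal (‖z‖ ^ 2) := fun z => by
    rw [ENNReal.ofReal_pow (norm_nonneg _), ofReal_norm]
  rw [e1]
  calc _ ≤ ENNReal.ofReal ((x ^ 2 + y ^ 2) * (‖d0‖ ^ 2 + ‖d1‖ ^ 2)) := by
        rw [e3]; exact ENNReal.ofReal_le_ofReal e2
    _ = ENNReal.ofReal (x ^ 2 + y ^ 2) * (‖d0‖ₑ ^ 2 + ‖d1‖ₑ ^ 2) := by
        rw [ENNReal.ofReal_mul (by positivity), ENNReal.ofReal_add (sq_nonneg ‖d0‖)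
          (sq_nonneg ‖d1‖), e3, e3]
    _ ≤ _ := mul_le_mul' le_rfl le_self_add

/-- In a field of half a flux quantum through the `z`-axis the kinetic energy is bounded below by a
multiple of the inverse squared distance to the axis. -/
theorem lintegral_inv_axisDistSq_le_kinetic (Ψ : WaveFunction q (n + 1)) {S : Set Space}
    (hS : MeasurableSet S) (h : ∀ᵐ x, x ∉ S → Ψ.density x = 0) {A : Space → Space}
    (hAc : Continuous A) (hA : ∀ x ∈ S, x 0 * A x 1 - x 1 * A x 0 = 1 / 2) :
    ∫⁻ x, (ENNReal.ofReal (axisDistSq x))⁻¹ * Ψ.density x ≤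
      ENNReal.ofReal (2 * Real.pi ^ 2) * Ψ.kinetic A := by
  have hW : Measurable (fun x => (ENNReal.ofReal (axisDistSq x))⁻¹) :=
    contDiff_axisDistSq.continuous.measurable.ennreal_ofReal.inv
  have key : ∀ s j, ∫⁻ r, (ENNReal.ofReal (axisDistSq (r j)))⁻¹ * ‖Ψ.ψ s r‖ₑ ^ 2 ≤
      ENNReal.ofReal (Real.pi ^ 2) * ∑ a,
        ∫⁻ r, ‖-Complex.I * Ψ.grad s j a r + ((A (r j) a : ℝ) : ℂ) * Ψ.ψ s r‖ₑ ^ 2 := by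
    intro s j
    have hloc : LocallyIntegrable (Ψ.ψ s) := (Ψ.memLp_ψ s).locallyIntegrable (by norm_num)
    have hcoord : ∀ a : Fin 3, Continuous (fun r : Config (n + 1) => ((r j a : ℝ) : ℂ)) := fun a =>
      Complex.continuous_ofReal.comp ((contDiff_coord a).continuous.comp (continuous_apply j))
    have hgl : LocallyIntegrable (fun r => ((r j 0 : ℝ) : ℂ) * Ψ.grad s j 1 r -
        ((r j 1 : ℝ) : ℂ) * Ψ.grad s j 0 r) :=
      (locallyIntegrable_continuous_mul ((Ψ.memLp_grad s j 1).locallyIntegrable (by norm_num))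
        (hcoord 0)).sub (locallyIntegrable_continuous_mul
          ((Ψ.memLp_grad s j 0).locallyIntegrable (by norm_num)) (hcoord 1))
    have hrot := RotationGenerator.lintegral_weight_le (J := axisRotation.particle j) hloc hgl
      (fun φ hφ hc => Ψ.integral_mul_fderiv_rotation s j hφ hc)
      (w := fun r => (ENNReal.ofReal (axisDistSq (r j)))⁻¹) (hW.comp (measurable_pi_apply j))
      (fun t r => by rw [RotationGenerator.particle_rot_self, axisDistSq_rot])
    refine hrot.trans (mul_le_mul' le_rfl ?_)
    refine le_trans (lintegral_mono_ae
      (g := fun r => ∑ a, ‖-Complex.I * Ψ.grad s j a r +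
        ((A (r j) a : ℝ) : ℂ) * Ψ.ψ s r‖ₑ ^ 2) ?_) (le_of_eq ?_)
    · filter_upwards [Ψ.ae_eq_zero_of_density hS h s j] with r hr
      have hor : Ψ.ψ s r = 0 ∨ r j 0 * A (r j) 1 - r j 1 * A (r j) 0 = 1 / 2 := by
        by_cases hrs : r j ∈ S
        · exact Or.inr (hA _ hrs)
        · exact Or.inl (hr hrs)
      rw [Fin.sum_univ_three]
      refine (mul_le_mul' le_rfl (enorm_rotation_sq_le
        (‖-Complex.I * Ψ.grad s j 2 r + ((A (r j) 2 : ℝ) : ℂ) * Ψ.ψ s r‖ₑ ^ 2) hor)).trans ?_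
      rw [← mul_assoc]
      -- The weight cancels the squared distance to the axis; on the axis itself the product is `⊤ *
      -- 0 = 0`, so only an inequality is available.
      exact mul_le_of_le_one_left' (ENNReal.inv_mul_le_one _)
    · refine lintegral_finsetSum' _ fun a _ => ?_
      refine (((Ψ.memLp_grad s j a).1.const_mul _).add
        (Continuous.aestronglyMeasurable ?_ |>.mul (Ψ.memLp_ψ s).1)).enorm.pow_const 2
      exact Complex.continuous_ofReal.comp ((contDiff_coord a).continuous.comp
        (hAc.comp (continuous_apply j)))
  rw [lintegral_weight_density Ψ hW, kinetic, ← mul_assoc]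
  have hc : ENNReal.ofReal (2 * Real.pi ^ 2) * 2⁻¹ = ENNReal.ofReal (Real.pi ^ 2) := by
    rw [mul_comm, ENNReal.ofReal_mul (by norm_num), ← mul_assoc]
    simp [ENNReal.inv_mul_cancel]
  rw [hc, Finset.sum_comm, Finset.mul_sum]
  refine Finset.sum_le_sum fun s _ => ?_
  rw [Finset.mul_sum]
  exact Finset.sum_le_sum fun j _ => key s j

end WaveFunction

/-- In a field of half a flux quantum through the `z`-axis the Grayce-Harris functional is bounded
below by a multiple of the mean inverse squared distance to the axis. -/
theorem lintegral_inv_axisDistSq_le_G (q n : ℕ) {ρ : Space → ℝ} {S : Set Space}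
    (hS : MeasurableSet S) (hρ : ∀ x, x ∉ S → ρ x = 0) {A : Space → Space}
    (hAc : Continuous A) (hA : ∀ x ∈ S, x 0 * A x 1 - x 1 * A x 0 = 1 / 2) :
    (ENNReal.ofReal (2 * Real.pi ^ 2))⁻¹ *
      ∫⁻ x, (ENNReal.ofReal (axisDistSq x))⁻¹ * ENNReal.ofReal (ρ x) ≤ G q n ρ A := by
  refine le_iInf₂ fun Γ hΓ => ?_
  rw [mul_comm, ← div_eq_mul_inv]
  refine ENNReal.div_le_of_le_mul' ?_
  have hW : Measurable (fun x => (ENNReal.ofReal (axisDistSq x))⁻¹) :=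
    contDiff_axisDistSq.continuous.measurable.ennreal_ofReal.inv
  have hi : ∀ i, (Γ.weight i : ℝ≥0∞) *
      ∫⁻ x, (ENNReal.ofReal (axisDistSq x))⁻¹ * (Γ.state i).density x ≤
      ENNReal.ofReal (2 * Real.pi ^ 2) * ((Γ.weight i : ℝ≥0∞) * (Γ.state i).energy A) := by
    intro i
    -- A state of weight zero is not constrained by the total density, but contributes nothing. One
    -- of positive weight must vanish where `ρ` does.
    by_cases hw : Γ.weight i = 0
    · simp [hw]
    · rw [mul_left_comm]
      refine mul_le_mul' le_rfl (((Γ.state i).lintegral_inv_axisDistSq_le_kinetic hS ?_ hAc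
        hA).trans (mul_le_mul' le_rfl le_self_add))
      filter_upwards [hΓ] with x hx hxs
      rw [hρ x hxs, ENNReal.ofReal_zero, MixedState.density, ENNReal.tsum_eq_zero] at hx
      exact (mul_eq_zero.1 (hx i)).resolve_left (by simpa using hw)
  calc ∫⁻ x, (ENNReal.ofReal (axisDistSq x))⁻¹ * ENNReal.ofReal (ρ x)
      = ∫⁻ x, ∑' i, (Γ.weight i : ℝ≥0∞) *
          ((ENNReal.ofReal (axisDistSq x))⁻¹ * (Γ.state i).density x) := by
        refine lintegral_congr_ae ?_
        filter_upwards [hΓ] with x hx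
        rw [← hx, MixedState.density, ← ENNReal.tsum_mul_left]
        exact tsum_congr fun i => mul_left_comm _ _ _
    _ = ∑' i, (Γ.weight i : ℝ≥0∞) *
          ∫⁻ x, (ENNReal.ofReal (axisDistSq x))⁻¹ * (Γ.state i).density x := by
        have hm : ∀ i, AEMeasurable (fun x => (Γ.weight i : ℝ≥0∞) *
            ((ENNReal.ofReal (axisDistSq x))⁻¹ * (Γ.state i).density x)) := fun i =>
          (hW.aemeasurable.mul (Γ.state i).aemeasurable_density).const_mul _
        rw [lintegral_tsum hm]
        exact tsum_congr fun i => lintegral_const_mul' _ _ ENNReal.coe_ne_top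
    _ ≤ _ := by
        rw [MixedState.energy, ← ENNReal.tsum_mul_left]
        exact ENNReal.tsum_le_tsum hi


/-! ### A profile with small Dirichlet energy and large mean inverse squared distance to the axis.
-/

section Profile

theorem volume_box (S : Fin 3 → Set ℝ) (hS : ∀ a, MeasurableSet (S a)) :
    volume {x : Space | ∀ a, x a ∈ S a} = ∏ a, volume (S a) := by
  have e := PiLp.volume_preserving_ofLp (Fin 3)
  have : {x : Space | ∀ a, x a ∈ S a} = (@WithLp.ofLp 2 (Fin 3 → ℝ)) ⁻¹' (Set.univ.pi S) := by
    ext x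
    simp
  rw [this, e.measure_preimage (MeasurableSet.univ_pi hS).nullMeasurableSet, volume_pi_pi]

theorem measurableSet_box (S : Fin 3 → Set ℝ) (hS : ∀ a, MeasurableSet (S a)) :
    MeasurableSet {x : Space | ∀ a, x a ∈ S a} := by
  rw [Set.ofPred_forall]
  exact MeasurableSet.iInter fun a => (contDiff_coord a).continuous.measurable (hS a)

/-- A smooth cutoff of the unit scale around the origin. -/
def originBump : ContDiffBump (0 : Space) := ⟨2, 4, by norm_num, by norm_num⟩

/-- A bump function with a hole of squared radius `4⁻ⁿ` around the `z`-axis. -/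
def ringProfile (n : ℕ) (x : Space) : ℝ :=
  Real.smoothTransition (4 ^ n * axisDistSq x - 1) * originBump x

theorem contDiff_ringProfile (n : ℕ) : ContDiff ℝ ∞ (ringProfile n) :=
  (Real.smoothTransition.contDiff.comp
    ((contDiff_const.mul contDiff_axisDistSq).sub contDiff_const)).mul originBump.contDiff

theorem hasCompactSupport_ringProfile (n : ℕ) : HasCompactSupport (ringProfile n) :=
  originBump.hasCompactSupport.mul_left

theorem ringProfile_nonneg (n : ℕ) (x : Space) : 0 ≤ ringProfile n x :=
  mul_nonneg (Real.smoothTransition.nonneg _) originBump.nonneg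

theorem lt_of_ringProfile_ne_zero {n : ℕ} {x : Space} (h : ringProfile n x ≠ 0) :
    (4 ^ n : ℝ)⁻¹ < axisDistSq x := by
  by_contra hn
  push Not at hn
  refine h ?_
  rw [ringProfile, Real.smoothTransition.zero_of_nonpos, zero_mul]
  have : (4 : ℝ) ^ n * axisDistSq x ≤ 4 ^ n * (4 ^ n : ℝ)⁻¹ := by gcongr
  rw [mul_inv_cancel₀ (by positivity)] at this
  linarith

theorem exists_bound_deriv_smoothTransition :
    ∃ C : ℝ, ∀ t, |deriv Real.smoothTransition t| ≤ C ∧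
      (deriv Real.smoothTransition t ≠ 0 → t ∈ Set.Icc (0 : ℝ) 1) := by
  have hz : ∀ t, deriv Real.smoothTransition t ≠ 0 → t ∈ Set.Icc (0 : ℝ) 1 := by
    intro t ht
    by_contra hn
    refine ht ?_
    rw [Set.mem_Icc, not_and_or, not_le, not_le] at hn
    rcases hn with hn | hn
    · have : Real.smoothTransition =ᶠ[nhds t] fun _ => 0 := by
        filter_upwards [Iio_mem_nhds hn] with y hy
        exact Real.smoothTransition.zero_of_nonpos (le_of_lt hy)
      rw [this.deriv_eq, deriv_const]
    · have : Real.smoothTransition =ᶠ[nhds t] fun _ => 1 := by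
        filter_upwards [Ioi_mem_nhds hn] with y hy
        exact Real.smoothTransition.one_of_one_le (le_of_lt hy)
      rw [this.deriv_eq, deriv_const]
  have hc : Continuous (deriv Real.smoothTransition) :=
    (Real.smoothTransition.contDiff (n := 1)).continuous_deriv le_rfl
  obtain ⟨C, hC⟩ := (isCompact_Icc (a := (0 : ℝ)) (b := 1)).exists_bound_of_continuousOn
    hc.continuousOn
  refine ⟨C, fun t => ⟨?_, hz t⟩⟩
  by_cases ht : deriv Real.smoothTransition t = 0
  · rw [ht, abs_zero]
    exact (norm_nonneg _).trans (hC 0 (by simp))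
  · exact hC t (hz t ht)

theorem sq_fderiv_axisDistSq_le (x : Space) (a : Fin 3) :
    (fderiv ℝ axisDistSq x (axis a)) ^ 2 ≤ 4 * axisDistSq x := by
  have h : ∀ b : Fin 3, HasFDerivAt (fun x : Space => x b)
      (EuclideanSpace.proj (𝕜 := ℝ) b) x := fun b =>
    (EuclideanSpace.proj (𝕜 := ℝ) b).hasFDerivAt
  have h2 : HasFDerivAt axisDistSq _ x := ((h 0).pow 2).add ((h 1).pow 2)
  rw [h2.fderiv]
  fin_cases a <;> simp [axis, axisDistSq] <;> nlinarith [sq_nonneg (x 0), sq_nonneg (x 1)]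

/-- The box containing the inner boundary layer of the ring profile. -/
def layerBox (n : ℕ) : Set Space :=
  {x | ∀ a, x a ∈ (![Set.Icc (-(2 * (2 ^ n : ℝ)⁻¹)) (2 * (2 ^ n : ℝ)⁻¹),
    Set.Icc (-(2 * (2 ^ n : ℝ)⁻¹)) (2 * (2 ^ n : ℝ)⁻¹), Set.Icc (-4) 4] : Fin 3 → Set ℝ) a}

theorem measurableSet_layerBox (n : ℕ) : MeasurableSet (layerBox n) := by
  refine measurableSet_box _ fun a => ?_
  fin_cases a <;> exact measurableSet_Icc

theorem volume_layerBox (n : ℕ) :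
    volume (layerBox n) = ENNReal.ofReal (128 * (4 ^ n : ℝ)⁻¹) := by
  rw [layerBox, volume_box _ (fun a => by fin_cases a <;> exact measurableSet_Icc),
    Fin.prod_univ_three]
  simp only [Matrix.cons_val_zero, Matrix.cons_val_one, Matrix.cons_val, Real.volume_Icc]
  rw [← ENNReal.ofReal_mul (by ring_nf; positivity), ← ENNReal.ofReal_mul (by ring_nf; positivity)]
  congr 1
  have : (4 ^ n : ℝ) = 2 ^ n * 2 ^ n := by rw [← mul_pow]; norm_num
  rw [this, mul_inv]
  ring

theorem abs_coord_le_norm (x : Space) (a : Fin 3) : |x a| ≤ ‖x‖ := by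
  have := PiLp.norm_apply_le x a
  simpa using this

theorem mem_layerBox {n : ℕ} {x : Space} (h : axisDistSq x ≤ 2 * (4 ^ n : ℝ)⁻¹)
    (h2 : ‖x‖ ≤ 4) : x ∈ layerBox n := by
  have h4 : (4 ^ n : ℝ)⁻¹ = (2 ^ n : ℝ)⁻¹ ^ 2 := by
    rw [← inv_pow, ← inv_pow, ← pow_mul, mul_comm, pow_mul]; norm_num
  have hp : (0 : ℝ) < (2 ^ n : ℝ)⁻¹ := by positivity
  have hb : ∀ t : ℝ, t ^ 2 ≤ axisDistSq x → t ∈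
      Set.Icc (-(2 * (2 ^ n : ℝ)⁻¹)) (2 * (2 ^ n : ℝ)⁻¹) := by
    intro t ht
    rw [Set.mem_Icc, ← abs_le]
    refine abs_le_of_sq_le_sq ?_ (by positivity)
    rw [h4] at h
    nlinarith
  intro a
  fin_cases a
  · exact hb (x 0) (by simp only [axisDistSq]; nlinarith [sq_nonneg (x 1)])
  · exact hb (x 1) (by simp only [axisDistSq]; nlinarith [sq_nonneg (x 0)])
  · exact abs_le.1 ((abs_coord_le_norm x 2).trans h2)

/-- The edge of the hole contributes only where 4ⁿs² ≤ 2, with s the distance to the axis. There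
|∂(s²)|² ≤ 4s² ≤ 8·4⁻ⁿ, so the squared gradient of the inner cutoff is at most 8C²4ⁿ. The other
factors 2 come from (a + b)² ≤ 2a² + 2b². -/
theorem sq_fderiv_ringProfile_le {C : ℝ} (hC : ∀ t, |deriv Real.smoothTransition t| ≤ C ∧
      (deriv Real.smoothTransition t ≠ 0 → t ∈ Set.Icc (0 : ℝ) 1)) (n : ℕ) (x : Space)
    (a : Fin 3) :
    (fderiv ℝ (ringProfile n) x (axis a)) ^ 2 ≤
      (layerBox n).indicator (fun _ => 16 * C ^ 2 * 4 ^ n) x +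
        2 * (fderiv ℝ originBump x (axis a)) ^ 2 := by
  set p : ℝ := deriv Real.smoothTransition (4 ^ n * axisDistSq x - 1)
  set g := fderiv ℝ axisDistSq x (axis a)
  set e := fderiv ℝ originBump x (axis a)
  set θ := Real.smoothTransition (4 ^ n * axisDistSq x - 1)
  have hd : fderiv ℝ (ringProfile n) x (axis a) = p * (4 ^ n * g) * originBump x + θ * e := by
    have h1 : HasFDerivAt axisDistSq (fderiv ℝ axisDistSq x) x :=
      (contDiff_axisDistSq.differentiable (by simp) x).hasFDerivAt
    have h2 : HasFDerivAt (fun x => 4 ^ n * axisDistSq x - 1)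
      ((4 ^ n : ℝ) • fderiv ℝ axisDistSq x) x := (h1.const_mul _).sub_const 1
    have h3 : HasDerivAt Real.smoothTransition p (4 ^ n * axisDistSq x - 1) :=
      ((Real.smoothTransition.contDiff (n := 1)).differentiable (by simp) _).hasDerivAt
    have h4 := h3.comp_hasFDerivAt x h2
    have h5 : HasFDerivAt originBump (fderiv ℝ originBump x) x :=
      ((originBump.contDiff (n := 1)).differentiable (by simp) x).hasFDerivAt
    have h6 : HasFDerivAt (ringProfile n) _ x := h4.mul h5
    rw [h6.fderiv]
    simp [p, g, e, θ]
    ring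
  have hθ : θ ^ 2 ≤ 1 := pow_le_one₀ (Real.smoothTransition.nonneg _)
    (Real.smoothTransition.le_one _)
  have hη : (originBump x) ^ 2 ≤ 1 := pow_le_one₀ originBump.nonneg originBump.le_one
  have hsplit : (fderiv ℝ (ringProfile n) x (axis a)) ^ 2 ≤
      2 * (p * (4 ^ n * g) * originBump x) ^ 2 + 2 * e ^ 2 := by
    rw [hd]
    nlinarith [sq_nonneg (p * (4 ^ n * g) * originBump x - θ * e),
      mul_le_mul_of_nonneg_right hθ (sq_nonneg e)]
  refine hsplit.trans (add_le_add_left ?_ _)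
  by_cases hp : p = 0 ∨ originBump x = 0
  · have : 0 ≤ (layerBox n).indicator (fun _ => 16 * C ^ 2 * 4 ^ n) x :=
      Set.indicator_nonneg (fun _ _ => by positivity) _
    rcases hp with hp | hp <;> simpa [hp] using this
  · push Not at hp
    have hx : ‖x‖ ≤ 4 := by
      by_contra hn
      exact hp.2 (originBump.zero_of_le_dist (by rw [dist_zero_right]; exact (not_le.1 hn).le))
    have h2 := ((hC _).2 hp.1).2
    have hpos : (0 : ℝ) < 4 ^ n := by positivity
    have hs : axisDistSq x ≤ 2 * (4 ^ n : ℝ)⁻¹ := by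
      rw [← div_eq_mul_inv, le_div_iff₀ hpos]
      linarith
    rw [Set.indicator_of_mem (mem_layerBox hs hx)]
    have hp2 : p ^ 2 ≤ C ^ 2 := by
      rw [← sq_abs p]
      exact pow_le_pow_left₀ (abs_nonneg _) (hC _).1 2
    have hg : g ^ 2 * 4 ^ n ≤ 8 := by
      have := sq_fderiv_axisDistSq_le x a
      nlinarith
    calc 2 * (p * (4 ^ n * g) * originBump x) ^ 2
        = 2 * (p ^ 2 * ((g ^ 2 * 4 ^ n) * 4 ^ n) * (originBump x) ^ 2) := by ring
      _ ≤ 2 * (C ^ 2 * (8 * 4 ^ n) * 1) := by gcongr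
      _ = 16 * C ^ 2 * 4 ^ n := by ring

/-- Disjoint boxes accumulating at the `z`-axis. -/
def scaleBox (k : ℕ) : Set Space :=
  {x | ∀ a, x a ∈ (![Set.Ioc ((2 ^ (k + 1) : ℝ)⁻¹) ((2 ^ k : ℝ)⁻¹),
    Set.Ioc 0 ((2 ^ k : ℝ)⁻¹), Set.Ioc 0 1] : Fin 3 → Set ℝ) a}

theorem measurableSet_scaleBox (k : ℕ) : MeasurableSet (scaleBox k) := by
  refine measurableSet_box _ fun a => ?_
  fin_cases a <;> exact measurableSet_Ioc

theorem volume_scaleBox (k : ℕ) :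
    volume (scaleBox k) = ENNReal.ofReal (2⁻¹ * (4 ^ k : ℝ)⁻¹) := by
  rw [scaleBox, volume_box _ (fun a => by fin_cases a <;> exact measurableSet_Ioc),
    Fin.prod_univ_three]
  simp only [Matrix.cons_val_zero, Matrix.cons_val_one, Matrix.cons_val, Real.volume_Ioc]
  have h1 : (2 ^ k : ℝ)⁻¹ - (2 ^ (k + 1) : ℝ)⁻¹ = 2⁻¹ * (2 ^ k : ℝ)⁻¹ := by
    rw [pow_succ, mul_inv]; ring
  rw [h1, ← ENNReal.ofReal_mul (by positivity), ← ENNReal.ofReal_mul (by ring_nf; positivity)]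
  congr 1
  have : (4 ^ k : ℝ) = 2 ^ k * 2 ^ k := by rw [← mul_pow]; norm_num
  rw [this, mul_inv]
  ring

theorem disjoint_scaleBox {k l : ℕ} (h : k < l) : Disjoint (scaleBox k) (scaleBox l) := by
  rw [Set.disjoint_left]
  intro x hk hl
  have h1 : (2 ^ (k + 1) : ℝ)⁻¹ < x 0 := (hk 0).1
  have h2 : x 0 ≤ (2 ^ l : ℝ)⁻¹ := (hl 0).2
  have h3 : (2 ^ l : ℝ)⁻¹ ≤ (2 ^ (k + 1) : ℝ)⁻¹ :=
    inv_anti₀ (by positivity) (pow_le_pow_right₀ (by norm_num) h)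
  linarith

/-- On this box the squared distance lies between 4⁻ᵏ/4 and 2·4⁻ᵏ. For `k < n` the lower bound
places the box outside the transition layer of the profile `n + 1`, which therefore equals 1 there.
-/
theorem inv_axisDistSq_ringProfile_ge {n k : ℕ} (hk : k < n) {x : Space} (hx : x ∈ scaleBox k) :
    ENNReal.ofReal (2⁻¹ * 4 ^ k) ≤ (ENNReal.ofReal (axisDistSq x))⁻¹ *
      ENNReal.ofReal (ringProfile (n + 1) x ^ 2) := by
  have h0 : (2 ^ (k + 1) : ℝ)⁻¹ < x 0 := (hx 0).1
  have h0' : x 0 ≤ (2 ^ k : ℝ)⁻¹ := (hx 0).2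
  have h1 : 0 < x 1 := (hx 1).1
  have h1' : x 1 ≤ (2 ^ k : ℝ)⁻¹ := (hx 1).2
  have h2 : 0 < x 2 := (hx 2).1
  have h2' : x 2 ≤ 1 := (hx 2).2
  have hp : (0 : ℝ) < (2 ^ k : ℝ)⁻¹ := by positivity
  have hp1 : (2 ^ k : ℝ)⁻¹ ≤ 1 := inv_le_one_of_one_le₀ (one_le_pow₀ (by norm_num))
  have h4 : (4 ^ k : ℝ)⁻¹ = (2 ^ k : ℝ)⁻¹ ^ 2 := by
    rw [← inv_pow, ← inv_pow, ← pow_mul, mul_comm, pow_mul]; norm_num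
  have e1 : (2 ^ (k + 1) : ℝ)⁻¹ = 2⁻¹ * (2 ^ k : ℝ)⁻¹ := by rw [pow_succ, mul_inv]; ring
  have hs : 0 < axisDistSq x := by unfold axisDistSq; nlinarith
  have hsu : axisDistSq x ≤ 2 * (4 ^ k : ℝ)⁻¹ := by unfold axisDistSq; rw [h4]; nlinarith
  have hsl : 4⁻¹ * (4 ^ k : ℝ)⁻¹ ≤ axisDistSq x := by
    unfold axisDistSq; rw [h4]; rw [e1] at h0; nlinarith
  have hball : ‖x‖ ≤ 2 := by
    rw [EuclideanSpace.norm_eq, Real.sqrt_le_left (by norm_num), Fin.sum_univ_three]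
    simp only [Real.norm_eq_abs, sq_abs]
    nlinarith
  have hη : originBump x = 1 :=
    originBump.one_of_mem_closedBall (by simpa [originBump] using hball)
  have hθ : Real.smoothTransition (4 ^ (n + 1) * axisDistSq x - 1) = 1 := by
    refine Real.smoothTransition.one_of_one_le ?_
    obtain ⟨m, rfl⟩ := Nat.exists_eq_add_of_lt hk
    have : (4 : ℝ) ^ (k + m + 1 + 1) * (4⁻¹ * (4 ^ k : ℝ)⁻¹) = 4 * 4 ^ m := by
      rw [show k + m + 1 + 1 = (k + m) + 2 by ring, pow_add, pow_add]
      field_simp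
    have h5 : (4 : ℝ) ^ (k + m + 1 + 1) * (4⁻¹ * (4 ^ k : ℝ)⁻¹) ≤
      4 ^ (k + m + 1 + 1) * axisDistSq x := by gcongr
    have h6 : (1 : ℝ) ≤ 4 ^ m := one_le_pow₀ (by norm_num)
    linarith
  rw [ringProfile, hη, hθ]
  simp only [mul_one, one_pow, ENNReal.ofReal_one]
  rw [← ENNReal.ofReal_inv_of_pos hs]
  refine ENNReal.ofReal_le_ofReal ?_
  rw [le_inv_comm₀ (by positivity) hs]
  refine hsu.trans (le_of_eq ?_)
  rw [mul_inv, inv_inv]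

/-- Each dyadic scale contributes at least (4ᵏ/2)(4⁻ᵏ/2) = 1/4, independently of `k`: this is the
logarithmic divergence of ∫ 1/s² in the plane. -/
theorem le_lintegral_ringProfile (n : ℕ) :
    (n : ℝ≥0∞) * ENNReal.ofReal 4⁻¹ ≤ ∫⁻ x, (ENNReal.ofReal (axisDistSq x))⁻¹ *
      ENNReal.ofReal (ringProfile (n + 1) x ^ 2) := by
  calc (n : ℝ≥0∞) * ENNReal.ofReal 4⁻¹
      = ∑ k ∈ Finset.range n, ENNReal.ofReal 4⁻¹ := by simp
    _ ≤ ∑ k ∈ Finset.range n, ∫⁻ x in scaleBox k, (ENNReal.ofReal (axisDistSq x))⁻¹ *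
      ENNReal.ofReal (ringProfile (n + 1) x ^ 2) := by
        refine Finset.sum_le_sum fun k hk => ?_
        calc ENNReal.ofReal 4⁻¹ = ∫⁻ _x in scaleBox k, ENNReal.ofReal (2⁻¹ * 4 ^ k) := by
              rw [setLIntegral_const, volume_scaleBox, ← ENNReal.ofReal_mul (by positivity)]
              congr 1
              field_simp
              norm_num
          _ ≤ _ := setLIntegral_mono' (measurableSet_scaleBox k) fun x hx =>
              inv_axisDistSq_ringProfile_ge (Finset.mem_range.1 hk) hx
    _ = ∫⁻ x in ⋃ k ∈ Finset.range n, scaleBox k, (ENNReal.ofReal (axisDistSq x))⁻¹ *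
      ENNReal.ofReal (ringProfile (n + 1) x ^ 2) := by
        rw [lintegral_biUnion_finset]
        · intro k _ l _ hkl
          rcases lt_or_gt_of_ne hkl with h | h
          · exact disjoint_scaleBox h
          · exact (disjoint_scaleBox h).symm
        · exact fun k _ => measurableSet_scaleBox k
    _ ≤ _ := setLIntegral_le_lintegral _ _

/-- The squared gradient at the edge of the hole grows like 4ⁿ while the volume of the layer is
128·4⁻ⁿ, so the product 16C²·128 = 2048C² is independent of `n`. -/
theorem exists_lintegral_fderiv_ringProfile_le : ∃ K : ℝ≥0∞, K ≠ ⊤ ∧ ∀ n,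
    ∑ a, ∫⁻ x, ENNReal.ofReal ((fderiv ℝ (ringProfile n) x (axis a)) ^ 2) ≤ K := by
  obtain ⟨C, hC⟩ := exists_bound_deriv_smoothTransition
  refine ⟨∑ a : Fin 3, (ENNReal.ofReal (2048 * C ^ 2) +
    ∫⁻ x, ENNReal.ofReal (2 * (fderiv ℝ originBump x (axis a)) ^ 2)), ?_, fun n => ?_⟩
  · refine (ENNReal.sum_lt_top.2 fun a _ => ENNReal.add_lt_top.2
      ⟨ENNReal.ofReal_lt_top, ?_⟩).ne
    have hcont : Continuous (fun x => 2 * (fderiv ℝ originBump x (axis a)) ^ 2) :=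
      continuous_const.mul ((((originBump.contDiff (n := 1)).continuous_fderiv
        (by simp)).clm_apply continuous_const).pow 2)
    have hcs : HasCompactSupport (fun x => 2 * (fderiv ℝ originBump x (axis a)) ^ 2) :=
      (originBump.hasCompactSupport.fderiv_apply (𝕜 := ℝ) (axis a)).comp_left
        (g := fun t : ℝ => 2 * t ^ 2) (by simp)
    exact (hcont.integrable_of_hasCompactSupport hcs).lintegral_lt_top
  · refine Finset.sum_le_sum fun a _ => ?_
    calc ∫⁻ x, ENNReal.ofReal ((fderiv ℝ (ringProfile n) x (axis a)) ^ 2)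
        ≤ ∫⁻ x, ((layerBox n).indicator (fun _ => ENNReal.ofReal (16 * C ^ 2 * 4 ^ n)) x +
          ENNReal.ofReal (2 * (fderiv ℝ originBump x (axis a)) ^ 2)) := by
          refine lintegral_mono fun x => ?_
          refine (ENNReal.ofReal_le_ofReal (sq_fderiv_ringProfile_le hC n x a)).trans ?_
          refine ENNReal.ofReal_add_le.trans (add_le_add_left (le_of_eq ?_) _)
          by_cases hx : x ∈ layerBox n <;> simp [hx]
      _ = _ := by
          rw [lintegral_add_left (measurable_const.indicator (measurableSet_layerBox n)),
            lintegral_indicator (measurableSet_layerBox n), setLIntegral_const, volume_layerBox,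
            ← ENNReal.ofReal_mul (by positivity)]
          congr 2
          field_simp
          ring

/-- The Dirichlet energy of a ring profile can be made small compared to its mean inverse squared
distance to the axis. -/
theorem exists_ringProfile (c : ℝ≥0∞) (hc : c ≠ ⊤) : ∃ n,
    c * ∑ a, ∫⁻ x, ENNReal.ofReal ((fderiv ℝ (ringProfile n) x (axis a)) ^ 2) <
      ∫⁻ x, (ENNReal.ofReal (axisDistSq x))⁻¹ * ENNReal.ofReal (ringProfile n x ^ 2) := by
  obtain ⟨K, hK, hKn⟩ := exists_lintegral_fderiv_ringProfile_le
  obtain ⟨m, hm⟩ := ENNReal.exists_nat_gt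
    (ENNReal.mul_ne_top (ENNReal.mul_ne_top hc hK) (by simp : (4 : ℝ≥0∞) ≠ ⊤))
  refine ⟨m + 1, lt_of_le_of_lt (mul_le_mul' le_rfl (hKn _))
    (lt_of_lt_of_le ?_ (le_lintegral_ringProfile m))⟩
  rw [ENNReal.ofReal_inv_of_pos (by norm_num), ← div_eq_mul_inv, ENNReal.lt_div_iff_mul_lt]
  · simpa using hm
  · simp
  · simp

end Profile


/-! ### Trial states: real orbitals dressed with a common phase. -/

theorem G_le_GPure (q n : ℕ) (ρ : Space → ℝ) (A : Space → Space) :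
    G q n ρ A ≤ GPure q n ρ A := by
  refine le_iInf₂ fun Ψ hΨ => ?_
  let Γ : MixedState q (n + 1) :=
    { weight := Pi.single 0 1
      hasSum_weight := hasSum_pi_single 0 1
      state := fun _ => Ψ }
  have hsum : ∀ c : ℝ≥0∞, ∑' i, (Γ.weight i : ℝ≥0∞) * c = c := by
    intro c
    rw [tsum_eq_single 0]
    · simp [Γ]
    · intro i hi
      simp [Γ, hi]
  refine (iInf₂_le Γ ?_).trans (hsum _).le
  filter_upwards [hΨ] with x hx
  rw [← hx]
  exact hsum (Ψ.density x)

/-- Nonnegative normalized smooth orbitals with disjoint compact supports. -/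
structure RealOrbitals (N : ℕ) where
  toFun : Fin N → Space → ℝ
  contDiff : ∀ i, ContDiff ℝ ∞ (toFun i)
  hasCompactSupport : ∀ i, HasCompactSupport (toFun i)
  nonneg : ∀ i x, 0 ≤ toFun i x
  normalized : ∀ i, ∫⁻ x, ENNReal.ofReal (toFun i x ^ 2) = 1
  disjoint : ∀ i j, i ≠ j → Disjoint (tsupport (toFun i)) (tsupport (toFun j))

namespace RealOrbitals

variable {N n q : ℕ} (φ : RealOrbitals N)

theorem enorm_mul_sq_of_norm_eq_one {t : ℝ} {z : ℂ} (h : t ≠ 0 → ‖z‖ = 1) :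
    ‖(t : ℂ) * z‖ₑ ^ 2 = ENNReal.ofReal (t ^ 2) := by
  by_cases ht : t = 0
  · simp [ht]
  · rw [← ofReal_norm, ← ENNReal.ofReal_pow (norm_nonneg _), norm_mul, h ht, mul_one,
      Complex.norm_real, Real.norm_eq_abs, sq_abs]

/-- Multiplication of the orbitals by a common phase. -/
def dress (w : Space → ℂ) (hw : ContDiff ℝ ∞ w) (hu : ∀ i x, φ.toFun i x ≠ 0 → ‖w x‖ = 1) :
    Orbitals N where
  toFun i x := ((φ.toFun i x : ℝ) : ℂ) * w x
  contDiff i := (Complex.ofRealCLM.contDiff.comp (φ.contDiff i)).mul hw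
  hasCompactSupport i := ((φ.hasCompactSupport i).comp_left (g := fun t : ℝ => (t : ℂ))
    Complex.ofReal_zero).mul_right
  normalized i := by
    simp_rw [enorm_mul_sq_of_norm_eq_one (hu i _)]
    exact φ.normalized i
  disjoint i j hij := by
    have h : ∀ i, tsupport (fun x => ((φ.toFun i x : ℝ) : ℂ) * w x) ⊆ tsupport (φ.toFun i) := by
      intro i
      refine closure_mono fun x hx h0 => hx ?_
      simp [h0]
    exact (φ.disjoint i j hij).mono (h i) (h j)

/-- The total density of the orbitals. -/
def rho (x : Space) : ℝ := ∑ i, φ.toFun i x ^ 2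

theorem rho_nonneg (x : Space) : 0 ≤ φ.rho x := Finset.sum_nonneg fun _ _ => sq_nonneg _

theorem ofReal_rho (x : Space) : ENNReal.ofReal (φ.rho x) =
    ∑ i, ENNReal.ofReal (φ.toFun i x ^ 2) :=
  ENNReal.ofReal_sum_of_nonneg fun _ _ => sq_nonneg _

/-- With disjoint supports the sum of squares is the square of the sum. Thus √ρ is smooth, although
a square root need not be. -/
theorem sqrt_rho (x : Space) : √(φ.rho x) = ∑ i, φ.toFun i x := by
  have h : φ.rho x = (∑ i, φ.toFun i x) ^ 2 := by
    by_cases h0 : ∀ i, φ.toFun i x = 0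
    · simp [rho, h0]
    · push Not at h0
      obtain ⟨i, hi⟩ := h0
      have hz : ∀ j ∈ Finset.univ, j ≠ i → φ.toFun j x = 0 := by
        intro j _ hji
        by_contra hn
        exact Set.disjoint_left.1 (φ.disjoint j i hji) (subset_tsupport _ hn)
          (subset_tsupport _ hi)
      rw [rho, Finset.sum_eq_single_of_mem i (Finset.mem_univ i) hz,
        Finset.sum_eq_single_of_mem i (Finset.mem_univ i)]
      intro j hj hji
      rw [hz j hj hji]
      simp
  rw [h, Real.sqrt_sq (Finset.sum_nonneg fun i _ => φ.nonneg i x)]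

theorem integral_sq (i : Fin N) : ∫ x, φ.toFun i x ^ 2 = 1 := by
  rw [integral_eq_lintegral_of_nonneg_ae (Filter.Eventually.of_forall fun _ => sq_nonneg _)
    ((φ.contDiff i).continuous.pow 2).aestronglyMeasurable, φ.normalized i]
  simp

theorem integrable_sq (i : Fin N) : Integrable (fun x => φ.toFun i x ^ 2) := by
  have hc : HasCompactSupport (fun x => φ.toFun i x * φ.toFun i x) :=
    (φ.hasCompactSupport i).mul_left
  simp_rw [sq]
  exact ((φ.contDiff i).continuous.mul (φ.contDiff i).continuous).integrable_of_hasCompactSupport hc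

theorem isDensity_rho : IsDensity N φ.rho where
  nonneg := φ.rho_nonneg
  integrable := integrable_finsetSum _ fun i _ => φ.integrable_sq i
  integral_eq := by
    simp only [rho]
    rw [integral_finsetSum _ fun i _ => φ.integrable_sq i]
    simp [φ.integral_sq]
  sqrt_memH1 a := by
    have hs : ContDiff ℝ ∞ (fun x => ((√(φ.rho x) : ℝ) : ℂ)) := by
      have h : ContDiff ℝ ∞ (fun x => ∑ i, φ.toFun i x) := ContDiff.sum fun i _ => φ.contDiff i
      simp_rw [sqrt_rho]
      exact Complex.ofRealCLM.contDiff.comp h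
    have hc : HasCompactSupport (fun x => ((√(φ.rho x) : ℝ) : ℂ)) := by
      have hK : IsCompact (⋃ i, tsupport (φ.toFun i)) :=
        isCompact_iUnion fun i => (φ.hasCompactSupport i).isCompact
      refine HasCompactSupport.of_support_subset_isCompact hK fun x hx => ?_
      by_contra hn
      refine hx ?_
      simp only [sqrt_rho]
      rw [Finset.sum_eq_zero, Complex.ofReal_zero]
      intro i _
      exact image_eq_zero_of_notMem_tsupport fun h => hn (Set.mem_iUnion.2 ⟨i, h⟩)
    exact ⟨_, memLp_fderiv_apply hs hc (axis a), hasWeakDeriv_fderiv hs (axis a)⟩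

variable {w : Space → ℂ} (hw : ContDiff ℝ ∞ w) (hu : ∀ i x, φ.toFun i x ≠ 0 → ‖w x‖ = 1)

/-- Gauge invariance: ∇w = -iAw makes the potential term cancel the derivative of the phase, leaving
-iw∇φ. Nothing is known of `w` where φ = 0, but such a point is a minimum of φ ≥ 0, so ∇φ vanishes
as well and both sides are zero. -/
theorem covDeriv_dress {A : Space → Space} (hA : ∀ i x, φ.toFun i x ≠ 0 → ∀ a,
      fderiv ℝ w x (axis a) = -Complex.I * ((A x a : ℝ) : ℂ) * w x) (i : Fin N) (a : Fin 3)
    (x : Space) :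
    ‖Orbitals.covDeriv A ((φ.dress w hw hu).toFun i) a x‖ₑ ^ 2 =
      ENNReal.ofReal ((fderiv ℝ (φ.toFun i) x (axis a)) ^ 2) := by
  have h1 : HasFDerivAt (fun x => ((φ.toFun i x : ℝ) : ℂ))
      (Complex.ofRealCLM.comp (fderiv ℝ (φ.toFun i) x)) x :=
    Complex.ofRealCLM.hasFDerivAt.comp x ((φ.contDiff i).differentiable (by simp) x).hasFDerivAt
  have h2 : HasFDerivAt w (fderiv ℝ w x) x := (hw.differentiable (by simp) x).hasFDerivAt
  have h3 : fderiv ℝ ((φ.dress w hw hu).toFun i) x = _ := (h1.mul h2).fderiv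
  rw [Orbitals.covDeriv, h3]
  by_cases h0 : φ.toFun i x = 0
  · have hmin : IsLocalMin (φ.toFun i) x :=
      Filter.Eventually.of_forall fun y => by rw [h0]; exact φ.nonneg i y
    have hz := hmin.fderiv_eq_zero
    simp [dress, h0, hz]
  · have := hA i x h0 a
    rw [← enorm_mul_sq_of_norm_eq_one (t := fderiv ℝ (φ.toFun i) x (axis a))
      (z := -Complex.I * w x) (fun _ => by simp [hu i x h0])]
    congr 2
    simp only [dress, _root_.add_apply, _root_.smul_apply, ContinuousLinearMap.comp_apply,
      Complex.ofRealCLM_apply, smul_eq_mul, this]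
    linear_combination ((A x a : ℝ) : ℂ) * (φ.toFun i x : ℂ) * w x * Complex.I_sq

theorem density_dress (φ : RealOrbitals (n + 1))
    (hu : ∀ i x, φ.toFun i x ≠ 0 → ‖w x‖ = 1) (s₀ : Fin q) (x : Space) :
    ((φ.dress w hw hu).waveFunction s₀).density x = ENNReal.ofReal (φ.rho x) := by
  rw [Orbitals.density_waveFunction, ofReal_rho]
  exact Finset.sum_congr rfl fun i _ => enorm_mul_sq_of_norm_eq_one (hu i x)

/-- Upper bound for the pure-state functional by the energy of a Slater determinant. -/
theorem GPure_rho_le (φ : RealOrbitals (n + 1)) (hq : 1 ≤ q)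
    (hu : ∀ i x, φ.toFun i x ≠ 0 → ‖w x‖ = 1) {d : ℝ} (hd : 0 < d)
    (hsep : ∀ i j, i ≠ j → ∀ x, φ.toFun i x ≠ 0 → ∀ y, φ.toFun j y ≠ 0 → d ≤ dist x y)
    {A : Space → Space} (hAc : Continuous A) :
    GPure q n φ.rho A ≤
      (2⁻¹ * ∑ i, ∑ a, ∫⁻ x, ‖Orbitals.covDeriv A ((φ.dress w hw hu).toFun i) a x‖ₑ ^ 2) +
        ((n + 1 : ℕ) : ℝ≥0∞) * (((n + 1 : ℕ) : ℝ≥0∞) * ENNReal.ofReal d⁻¹) := by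
  refine (iInf₂_le ((φ.dress w hw hu).waveFunction (⟨0, hq⟩ : Fin q))
    (Filter.Eventually.of_forall (φ.density_dress hw hu _))).trans ?_
  rw [WaveFunction.energy, Orbitals.kinetic_waveFunction _ _ hAc]
  refine add_le_add le_rfl (Orbitals.repulsion_waveFunction_le _ _ hd fun i j hij x hx y hy =>
    hsep i j hij x (fun h => hx ?_) y (fun h => hy ?_))
  · simp [dress, h]
  · simp [dress, h]

theorem GPure_rho_lt_top (φ : RealOrbitals (n + 1)) (hq : 1 ≤ q) {d : ℝ} (hd : 0 < d)
    (hsep : ∀ i j, i ≠ j → ∀ x, φ.toFun i x ≠ 0 → ∀ y, φ.toFun j y ≠ 0 → d ≤ dist x y)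
    {A : Space → Space} (hA : Continuous A) : GPure q n φ.rho A < ⊤ := by
  refine lt_of_le_of_lt (φ.GPure_rho_le (w := fun _ => 1) contDiff_const hq
      (fun _ _ _ => norm_one) hd hsep hA)
    (ENNReal.add_lt_top.2 ⟨ENNReal.mul_lt_top (by simp) ?_, ?_⟩)
  · refine ENNReal.sum_lt_top.2 fun i _ => ENNReal.sum_lt_top.2 fun a _ => ?_
    set u := φ.dress (fun _ => 1) contDiff_const (fun _ _ _ => norm_one)
    refine lintegral_enorm_sq_lt_top ((Orbitals.continuous_covDeriv hA
      (u.contDiff i) a).memLp_of_hasCompactSupport ?_)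
    refine HasCompactSupport.of_support_subset_isCompact (u.hasCompactSupport i).isCompact ?_
    intro x hx
    by_contra hn
    refine hx ?_
    rw [Orbitals.covDeriv, u.toFun_eq_zero _ _ hn, fderiv_of_notMem_tsupport ℝ hn]
    simp
  · exact ENNReal.mul_lt_top (by simp) (ENNReal.mul_lt_top (by simp) (by simp))

end RealOrbitals

/-! ### The potential of one flux quantum and its compensating phase. -/

section Flux

/-- A smooth function on the line, equal to `1/√s` for `s ≥ 4⁻ⁿ`. -/
def invSqrtCutoff (n : ℕ) (s : ℝ) : ℝ :=
  Real.smoothTransition (2 * 4 ^ n * s - 1) * (√s)⁻¹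

theorem invSqrtCutoff_of_le {n : ℕ} {s : ℝ} (h : (4 ^ n : ℝ)⁻¹ ≤ s) :
    invSqrtCutoff n s = (√s)⁻¹ := by
  rw [invSqrtCutoff, Real.smoothTransition.one_of_one_le, one_mul]
  have : (4 ^ n : ℝ) * (4 ^ n : ℝ)⁻¹ ≤ 4 ^ n * s := by gcongr
  rw [mul_inv_cancel₀ (by positivity)] at this
  linarith

theorem contDiff_invSqrtCutoff (n : ℕ) : ContDiff ℝ ∞ (invSqrtCutoff n) := by
  rw [contDiff_iff_contDiffAt]
  intro s
  have hpos : (0 : ℝ) < 4 ^ n := by positivity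
  by_cases hs : 0 < s
  · refine ContDiffAt.mul ?_ ((Real.contDiffAt_sqrt hs.ne').inv (Real.sqrt_pos.2 hs).ne')
    exact (Real.smoothTransition.contDiff.comp
      ((contDiff_const.mul contDiff_id).sub contDiff_const)).contDiffAt
  -- The cutoff vanishes below (2·4ⁿ)⁻¹, so the function is locally zero near every `s ≤ 0` and the
  -- singularity of the root is not seen.
  · have hlt : s < (2 * 4 ^ n : ℝ)⁻¹ := lt_of_le_of_lt (not_lt.1 hs) (by positivity)
    refine (contDiffAt_const (c := (0 : ℝ))).congr_of_eventuallyEq ?_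
    filter_upwards [Iio_mem_nhds hlt] with t ht
    rw [invSqrtCutoff, Real.smoothTransition.zero_of_nonpos, zero_mul]
    have : (2 * 4 ^ n : ℝ) * t ≤ 2 * 4 ^ n * (2 * 4 ^ n : ℝ)⁻¹ :=
      mul_le_mul_of_nonneg_left (le_of_lt ht) (by positivity)
    rw [mul_inv_cancel₀ (by positivity)] at this
    linarith

/-- A smooth function equal to `e^{-iθ}` at the squared distance at least `4⁻ⁿ` to the `z`-axis. -/
def phase (n : ℕ) (x : Space) : ℂ :=
  ((invSqrtCutoff n (axisDistSq x) : ℝ) : ℂ) * (((x 0 : ℝ) : ℂ) - Complex.I * ((x 1 : ℝ) : ℂ))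

theorem contDiff_phase (n : ℕ) : ContDiff ℝ ∞ (phase n) :=
  (Complex.ofRealCLM.contDiff.comp ((contDiff_invSqrtCutoff n).comp contDiff_axisDistSq)).mul
    ((Complex.ofRealCLM.contDiff.comp (contDiff_coord 0)).sub
      (contDiff_const.mul (Complex.ofRealCLM.contDiff.comp (contDiff_coord 1))))

theorem norm_phase {n : ℕ} {x : Space} (h : (4 ^ n : ℝ)⁻¹ ≤ axisDistSq x) : ‖phase n x‖ = 1 := by
  have hs : 0 < axisDistSq x := lt_of_lt_of_le (by positivity) h
  have h1 : ‖((x 0 : ℝ) : ℂ) - Complex.I * ((x 1 : ℝ) : ℂ)‖ = √(axisDistSq x) := by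
    rw [Complex.norm_def, Complex.normSq_apply, axisDistSq]
    congr 1
    simp
    ring
  rw [phase, invSqrtCutoff_of_le h, norm_mul, h1, Complex.norm_real, norm_inv,
    Real.norm_of_nonneg (Real.sqrt_nonneg _), inv_mul_cancel₀ (Real.sqrt_pos.2 hs).ne']

/-- A vector potential carrying one flux quantum through the `z`-axis, cut off by `χ`. -/
def fluxPotential (n : ℕ) (χ : Space → ℝ) (x : Space) : Space :=
  (χ x * invSqrtCutoff n (axisDistSq x) ^ 2) • axisGen x

theorem fluxPotential_mem (n : ℕ) {χ : Space → ℝ} (h : ContDiff ℝ ∞ χ)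
    (hc : HasCompactSupport χ) : fluxPotential n χ ∈ vectorPotentials := by
  refine ⟨(h.mul (((contDiff_invSqrtCutoff n).comp contDiff_axisDistSq).pow 2)).smul
    axisGen.contDiff, ?_⟩
  exact (hc.mul_right (f' := fun x => invSqrtCutoff n (axisDistSq x) ^ 2)).smul_right

theorem fluxPotential_zero (n : ℕ) (χ : Space → ℝ) (x : Space) :
    fluxPotential n χ x 0 = -(χ x * invSqrtCutoff n (axisDistSq x) ^ 2 * x 1) := by
  simp [fluxPotential, axisGen_apply, axis]

theorem fluxPotential_one (n : ℕ) (χ : Space → ℝ) (x : Space) :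
    fluxPotential n χ x 1 = χ x * invSqrtCutoff n (axisDistSq x) ^ 2 * x 0 := by
  simp [fluxPotential, axisGen_apply, axis]

theorem fluxPotential_two (n : ℕ) (χ : Space → ℝ) (x : Space) :
    fluxPotential n χ x 2 = 0 := by
  simp [fluxPotential, axisGen_apply, axis]

theorem sq_invSqrtCutoff_mul {n : ℕ} {x : Space} (h : (4 ^ n : ℝ)⁻¹ ≤ axisDistSq x) :
    invSqrtCutoff n (axisDistSq x) ^ 2 * (x 0 ^ 2 + x 1 ^ 2) = 1 := by
  have hs : 0 < axisDistSq x := lt_of_lt_of_le (by positivity) h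
  rw [invSqrtCutoff_of_le h, inv_pow, Real.sq_sqrt hs.le]
  exact inv_mul_cancel₀ hs.ne'

theorem fluxPotential_rot {n : ℕ} {χ : Space → ℝ} {x : Space}
    (h : (4 ^ n : ℝ)⁻¹ ≤ axisDistSq x) (hχ : χ x = 1) :
    x 0 * fluxPotential n χ x 1 - x 1 * fluxPotential n χ x 0 = 1 := by
  rw [fluxPotential_zero, fluxPotential_one, hχ]
  linear_combination sq_invSqrtCutoff_mul h

/-- Away from the axis the phase is e^{-iθ} and the potential is ∇θ. The inequality `h` is strict so
that the cutoff is inactive in a whole neighbourhood and does not affect the derivative. -/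
theorem fderiv_phase {n : ℕ} {χ : Space → ℝ} {x : Space} (h : (4 ^ n : ℝ)⁻¹ < axisDistSq x)
    (hχ : χ x = 1) (a : Fin 3) :
    fderiv ℝ (phase n) x (axis a) =
      -Complex.I * ((fluxPotential n χ x a : ℝ) : ℂ) * phase n x := by
  have hs : 0 < axisDistSq x := lt_trans (by positivity) h
  have ht : 0 < √(axisDistSq x) := Real.sqrt_pos.2 hs
  set κ := invSqrtCutoff n (axisDistSq x) with hκ
  have hκt : κ = (√(axisDistSq x))⁻¹ := invSqrtCutoff_of_le h.le
  have hd : HasDerivAt (invSqrtCutoff n) (-(1 / 2) * κ ^ 3) (axisDistSq x) := by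
    have h1 := (Real.hasDerivAt_sqrt hs.ne').fun_inv ht.ne'
    have h2 : invSqrtCutoff n =ᶠ[nhds (axisDistSq x)] fun s => (√s)⁻¹ := by
      filter_upwards [Ioi_mem_nhds h] with s hs
      exact invSqrtCutoff_of_le (le_of_lt hs)
    refine (h1.congr_of_eventuallyEq h2).congr_deriv ?_
    rw [hκt]
    field_simp
  have hc : ∀ b : Fin 3, HasFDerivAt (fun x : Space => x b)
      (EuclideanSpace.proj (𝕜 := ℝ) b) x := fun b =>
    (EuclideanSpace.proj (𝕜 := ℝ) b).hasFDerivAt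
  have hsd : HasFDerivAt axisDistSq _ x := ((hc 0).pow 2).add ((hc 1).pow 2)
  have h1 := Complex.ofRealCLM.hasFDerivAt.comp x (hd.comp_hasFDerivAt x hsd)
  have h2 := Complex.ofRealCLM.hasFDerivAt.comp x (hc 0)
  have h3 := Complex.ofRealCLM.hasFDerivAt.comp x (hc 1)
  have h4 : fderiv ℝ (phase n) x = _ := (h1.mul (h2.sub (h3.const_mul Complex.I))).fderiv
  have hk : (κ : ℂ) ^ 2 * ((x 0 : ℂ) ^ 2 + (x 1 : ℂ) ^ 2) = 1 := by
    have := congrArg (fun t : ℝ => (t : ℂ)) (sq_invSqrtCutoff_mul h.le)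
    push_cast at this
    exact this
  rw [h4, phase]
  fin_cases a
  · simp [axis, fluxPotential_zero, hχ, ← hκ]
    linear_combination (-(κ : ℂ)) * hk + (κ : ℂ) ^ 3 * (x 1 : ℂ) ^ 2 * Complex.I_sq
  · simp [axis, fluxPotential_one, hχ, ← hκ]
    linear_combination (Complex.I * (κ : ℂ)) * hk -
      (κ : ℂ) ^ 3 * (x 0 : ℂ) * (x 1 : ℂ) * Complex.I_sq
  · simp [axis, fluxPotential_two]

end Flux


/-! ### Normalized translates of the profile along the axis. -/

section RingOrbitals

theorem norm_lt_of_ringProfile_ne_zero {n : ℕ} {x : Space} (h : ringProfile n x ≠ 0) :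
    ‖x‖ < 4 := by
  by_contra hn
  refine h ?_
  rw [ringProfile, originBump.zero_of_le_dist (by rw [dist_zero_right]; exact not_lt.1 hn),
    mul_zero]

/-- The squared `L²` norm of the ring profile. -/
def ringMass (n : ℕ) : ℝ := (∫⁻ x, ENNReal.ofReal (ringProfile n x ^ 2)).toReal

theorem ofReal_ringMass (n : ℕ) :
    ENNReal.ofReal (ringMass n) = ∫⁻ x, ENNReal.ofReal (ringProfile n x ^ 2) := by
  refine ENNReal.ofReal_toReal (Integrable.lintegral_lt_top ?_).ne
  have hc : HasCompactSupport (fun x => ringProfile n x * ringProfile n x) :=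
    (hasCompactSupport_ringProfile n).mul_left
  simp_rw [sq]
  exact ((contDiff_ringProfile n).continuous.mul
    (contDiff_ringProfile n).continuous).integrable_of_hasCompactSupport hc

/-- The normalized translates of a ring profile along the `z`-axis. -/
def ringOrbital (n : ℕ) (S : ℝ) (i : ℕ) (x : Space) : ℝ :=
  (√(ringMass n))⁻¹ * ringProfile n (x - ((i : ℝ) * S) • axis 2)

theorem norm_axis (a : Fin 3) : ‖axis a‖ = 1 := by simp [axis]

theorem dist_center_ge {S : ℝ} (hS : 0 < S) {i j : ℕ} (h : i ≠ j) :
    S ≤ dist (((i : ℝ) * S) • axis 2) (((j : ℝ) * S) • axis 2) := by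
  rw [dist_eq_norm, ← sub_smul, norm_smul, norm_axis, mul_one, ← sub_mul, norm_mul,
    Real.norm_of_nonneg hS.le]
  refine le_mul_of_one_le_left hS.le ?_
  have : (1 : ℤ) ≤ |(i : ℤ) - j| := Int.one_le_abs (by omega)
  rw [Real.norm_eq_abs]
  exact_mod_cast this

theorem axisDistSq_sub (x : Space) (t : ℝ) : axisDistSq (x - t • axis 2) = axisDistSq x := by
  simp [axisDistSq, axis]

theorem ringProfile_ne_zero_of_ringOrbital {n : ℕ} {S : ℝ} {i : ℕ} {x : Space}
    (h : ringOrbital n S i x ≠ 0) : ringProfile n (x - ((i : ℝ) * S) • axis 2) ≠ 0 :=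
  right_ne_zero_of_mul h

theorem tsupport_ringOrbital_subset (n : ℕ) (S : ℝ) (i : ℕ) :
    tsupport (ringOrbital n S i) ⊆ Metric.closedBall (((i : ℝ) * S) • axis 2) 4 := by
  refine closure_minimal (fun x hx => ?_) Metric.isClosed_closedBall
  rw [Metric.mem_closedBall, dist_eq_norm]
  exact (norm_lt_of_ringProfile_ne_zero (ringProfile_ne_zero_of_ringOrbital hx)).le

theorem sub_le_dist_of_mem_closedBall {S : ℝ} (hS : 0 < S) {i j : ℕ} (h : i ≠ j) {x y : Space}
    (hx : x ∈ Metric.closedBall (((i : ℝ) * S) • axis 2) 4)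
    (hy : y ∈ Metric.closedBall (((j : ℝ) * S) • axis 2) 4) : S - 8 ≤ dist x y := by
  have h1 := dist_center_ge hS h
  rw [Metric.mem_closedBall] at hx hy
  have h2 := dist_triangle4_right (((i : ℝ) * S) • axis 2) (((j : ℝ) * S) • axis 2) x y
  rw [dist_comm] at hx hy
  linarith

theorem sq_ringOrbital (n : ℕ) (S : ℝ) (i : ℕ) (x : Space) :
    ENNReal.ofReal (ringOrbital n S i x ^ 2) = ENNReal.ofReal (ringMass n)⁻¹ *
      ENNReal.ofReal (ringProfile n (x - ((i : ℝ) * S) • axis 2) ^ 2) := by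
  have : 0 ≤ ringMass n := ENNReal.toReal_nonneg
  rw [ringOrbital, mul_pow, inv_pow, Real.sq_sqrt this, ENNReal.ofReal_mul (by positivity)]

theorem fderiv_ringOrbital (n : ℕ) (S : ℝ) (i : ℕ) (x v : Space) :
    ENNReal.ofReal (fderiv ℝ (ringOrbital n S i) x v ^ 2) = ENNReal.ofReal (ringMass n)⁻¹ *
      ENNReal.ofReal (fderiv ℝ (ringProfile n) (x - ((i : ℝ) * S) • axis 2) v ^ 2) := by
  have hm : 0 ≤ ringMass n := ENNReal.toReal_nonneg
  have h1 : HasFDerivAt (ringOrbital n S i) ((√(ringMass n))⁻¹ •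
      (fderiv ℝ (ringProfile n) (x - ((i : ℝ) * S) • axis 2))) x := by
    have h2 := ((contDiff_ringProfile n).differentiable (by simp)
      (x - ((i : ℝ) * S) • axis 2)).hasFDerivAt
    exact (HasFDerivAt.comp x h2
      ((hasFDerivAt_id x).sub_const (((i : ℝ) * S) • axis 2))).const_mul _
  rw [h1.fderiv, _root_.smul_apply, smul_eq_mul, mul_pow, inv_pow, Real.sq_sqrt hm,
    ENNReal.ofReal_mul (by positivity)]

/-- Well separated rings of unit mass along the `z`-axis. -/
def ringOrbitals (n N : ℕ) (hn : 0 < ringMass n) (S : ℝ) (hS : 8 < S) : RealOrbitals N where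
  toFun i := ringOrbital n S i
  contDiff i := contDiff_const.mul ((contDiff_ringProfile n).comp (contDiff_id.sub contDiff_const))
  hasCompactSupport i := HasCompactSupport.of_support_subset_isCompact
    (isCompact_closedBall _ _) ((subset_tsupport _).trans (tsupport_ringOrbital_subset n S i))
  nonneg i x := mul_nonneg (by positivity) (ringProfile_nonneg _ _)
  normalized i := by
    simp_rw [sq_ringOrbital]
    rw [lintegral_const_mul' _ _ ENNReal.ofReal_ne_top,
      lintegral_sub_right_eq_self (fun x => ENNReal.ofReal (ringProfile n x ^ 2)),
      ← ofReal_ringMass, ← ENNReal.ofReal_mul (by positivity), inv_mul_cancel₀ hn.ne',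
      ENNReal.ofReal_one]
  disjoint i j hij := by
    rw [Set.disjoint_left]
    intro x hx hy
    have := sub_le_dist_of_mem_closedBall (by linarith : 0 < S) (Fin.val_ne_of_ne hij)
      (tsupport_ringOrbital_subset n S i hx) (tsupport_ringOrbital_subset n S j hy)
    rw [dist_self] at this
    linarith

theorem lt_of_ringOrbital_ne_zero {n : ℕ} {S : ℝ} {i : ℕ} {x : Space}
    (h : ringOrbital n S i x ≠ 0) : (4 ^ n : ℝ)⁻¹ < axisDistSq x := by
  rw [← axisDistSq_sub x ((i : ℝ) * S)]
  exact lt_of_ringProfile_ne_zero (ringProfile_ne_zero_of_ringOrbital h)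

theorem norm_le_of_ringOrbital_ne_zero {n : ℕ} {S : ℝ} (hS : 0 < S) {N i : ℕ} (hi : i < N)
    {x : Space} (h : ringOrbital n S i x ≠ 0) : ‖x‖ ≤ N * S + 4 := by
  have h1 := norm_lt_of_ringProfile_ne_zero (ringProfile_ne_zero_of_ringOrbital h)
  have h2 : ‖x‖ ≤ ‖x - ((i : ℝ) * S) • axis 2‖ + ‖((i : ℝ) * S) • axis 2‖ := by
    simpa using norm_add_le (x - ((i : ℝ) * S) • axis 2) (((i : ℝ) * S) • axis 2)
  rw [norm_smul, norm_axis, mul_one, Real.norm_of_nonneg (by positivity)] at h2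
  have h3 : (i : ℝ) ≤ N := by exact_mod_cast hi.le
  have h4 : (i : ℝ) * S ≤ N * S := by gcongr
  linarith

end RingOrbitals

/-! ### Choice of the parameters and failure of midpoint convexity. -/

/-- Convexity would bound the midpoint value by `U`. Finiteness there is essential, because
`ENNReal.toReal` sends `⊤` to 0. -/
theorem not_convexOn_of_midpoint {F : (Space → Space) → ℝ≥0∞} {A : Space → Space} {U : ℝ≥0∞}
    (h0 : (0 : Space → Space) ∈ vectorPotentials) (hA : A ∈ vectorPotentials)
    (hF0 : F 0 ≤ U) (hFA : F A ≤ U) (hm : U < F ((1 / 2 : ℝ) • A))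
    (htop : F ((1 / 2 : ℝ) • A) ≠ ⊤) :
    ¬ ConvexOn ℝ vectorPotentials (fun A => (F A).toReal) := by
  intro hconv
  have h := hconv.2 h0 hA (by norm_num : (0 : ℝ) ≤ 1 / 2) (by norm_num : (0 : ℝ) ≤ 1 / 2)
    (by norm_num)
  rw [smul_zero, zero_add, smul_eq_mul, smul_eq_mul] at h
  have hU : U ≠ ⊤ := hm.ne_top
  have h1 := ENNReal.toReal_mono hU hF0
  have h2 := ENNReal.toReal_mono hU hFA
  have h3 := ENNReal.toReal_strict_mono htop hm
  linarith

/-- There is a density whose functionals are larger at half a flux quantum than at zero and at one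
flux quantum. -/
theorem exists_density_flux_barrier (q n : ℕ) (hq : 1 ≤ q) :
    ∃ ρ : Space → ℝ, IsDensity (n + 1) ρ ∧
      (∀ A ∈ vectorPotentials, GPure q n ρ A < ⊤) ∧
      ∃ A ∈ vectorPotentials, ∃ U : ℝ≥0∞, GPure q n ρ 0 ≤ U ∧ GPure q n ρ A ≤ U ∧
        U < G q n ρ ((1 / 2 : ℝ) • A) := by
  -- The factor π² compares the upper bound NcK/2 with the lower bound NcM/(2π²), where c is the
  -- inverse mass of the profile.
  obtain ⟨m, hm⟩ := exists_ringProfile (ENNReal.ofReal (Real.pi ^ 2)) ENNReal.ofReal_ne_top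
  set K := ∑ a, ∫⁻ x, ENNReal.ofReal ((fderiv ℝ (ringProfile m) x (axis a)) ^ 2) with hK
  set M := ∫⁻ x, (ENNReal.ofReal (axisDistSq x))⁻¹ * ENNReal.ofReal (ringProfile m x ^ 2) with hM
  have hmass : 0 < ringMass m := by
    by_contra hn
    have h0 : ∫⁻ x, ENNReal.ofReal (ringProfile m x ^ 2) = 0 := by
      rw [← ofReal_ringMass, ENNReal.ofReal_eq_zero]
      exact not_lt.1 hn
    have hmeas : Measurable (fun x => ENNReal.ofReal (ringProfile m x ^ 2)) :=
      ((contDiff_ringProfile m).continuous.pow 2).measurable.ennreal_ofReal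
    rw [lintegral_eq_zero_iff hmeas] at h0
    have : M = 0 := by
      rw [hM, lintegral_eq_zero_of_ae_eq_zero]
      filter_upwards [h0] with x hx
      have hx' : ENNReal.ofReal (ringProfile m x ^ 2) = 0 := hx
      simp [hx']
    rw [this] at hm
    exact absurd hm not_lt_zero
  set c := ENNReal.ofReal (ringMass m)⁻¹ with hc
  have hc0 : c ≠ 0 := by simpa [hc] using hmass
  have hct : c ≠ ⊤ := ENNReal.ofReal_ne_top
  set X : ℝ≥0∞ := 2⁻¹ * (((n + 1 : ℕ) : ℝ≥0∞) * (c * K)) with hX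
  set Y : ℝ≥0∞ := (ENNReal.ofReal (2 * Real.pi ^ 2))⁻¹ * (((n + 1 : ℕ) : ℝ≥0∞) * (c * M)) with hY
  have hXY : X < Y := by
    set p := ENNReal.ofReal (Real.pi ^ 2) with hp
    have hp0 : p ≠ 0 := by
      rw [hp, Ne, ENNReal.ofReal_eq_zero, not_le]
      positivity
    have hpt : p ≠ ⊤ := ENNReal.ofReal_ne_top
    have h2 : (ENNReal.ofReal (2 * Real.pi ^ 2))⁻¹ = 2⁻¹ * p⁻¹ := by
      rw [ENNReal.ofReal_mul (by norm_num), ENNReal.mul_inv (by simp) (by simp), ← hp]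
      simp
    have e1 : X = 2⁻¹ * p⁻¹ * ((n + 1 : ℕ) : ℝ≥0∞) * c * (p * K) := by
      calc X = (p⁻¹ * p) * X := by rw [ENNReal.inv_mul_cancel hp0 hpt, one_mul]
        _ = _ := by rw [hX]; ring
    have e2 : Y = 2⁻¹ * p⁻¹ * ((n + 1 : ℕ) : ℝ≥0∞) * c * M := by
      rw [hY, h2]; ring
    rw [e1, e2]
    refine (ENNReal.mul_lt_mul_iff_right ?_ ?_).2 hm
    · exact mul_ne_zero (mul_ne_zero (mul_ne_zero (by simp) (ENNReal.inv_ne_zero.2 hpt))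
        (by exact_mod_cast n.succ_ne_zero)) hc0
    · exact ENNReal.mul_ne_top (ENNReal.mul_ne_top (ENNReal.mul_ne_top (by simp)
        (ENNReal.inv_ne_top.2 hp0)) (ENNReal.natCast_ne_top _)) hct
  -- The gap leaves a positive budget `ε` for the repulsion.
  obtain ⟨ε, hε, hXε⟩ := ENNReal.lt_iff_exists_add_pos_lt.1 hXY
  set N : ℝ := ((n + 1 : ℕ) : ℝ) with hN
  have hNpos : 0 < N := by rw [hN]; positivity
  -- With this distance the repulsion bound `N * N / d` is exactly `ε`.
  set d : ℝ := N * N / ε with hd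
  have hdpos : 0 < d := div_pos (mul_pos hNpos hNpos) hε
  -- Each ring lies in a ball of radius 4, so centres spaced by `d + 8` leave a distance `d` between
  -- the supports.
  have hS : 8 < d + 8 := by linarith
  have hSpos : 0 < d + 8 := by linarith
  set φ := ringOrbitals m (n + 1) hmass (d + 8) hS with hφ
  have hsep : ∀ i j, i ≠ j → ∀ x, φ.toFun i x ≠ 0 → ∀ y, φ.toFun j y ≠ 0 → d ≤ dist x y := by
    intro i j hij x hx y hy
    have := sub_le_dist_of_mem_closedBall hSpos (Fin.val_ne_of_ne hij)
      (tsupport_ringOrbital_subset m _ i (subset_tsupport _ hx))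
      (tsupport_ringOrbital_subset m _ j (subset_tsupport _ hy))
    linarith
  have hrep : ((n + 1 : ℕ) : ℝ≥0∞) * (((n + 1 : ℕ) : ℝ≥0∞) * ENNReal.ofReal d⁻¹) = ε := by
    rw [← ENNReal.ofReal_natCast, ← ENNReal.ofReal_mul hNpos.le, ← ENNReal.ofReal_mul hNpos.le, hd,
      ← ENNReal.ofReal_coe_nnreal]
    congr 1
    field_simp
  have hR : (0 : ℝ) < N * (d + 8) + 4 := by positivity
  -- The inner radius exceeds the norm of every point where an orbital is nonzero, so the cutoff
  -- gives `A` compact support without changing it where the density lives.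
  let χ : ContDiffBump (0 : Space) :=
    ⟨N * (d + 8) + 4, N * (d + 8) + 5, hR, by linarith⟩
  have hs : ∀ i x, φ.toFun i x ≠ 0 → (4 ^ m : ℝ)⁻¹ < axisDistSq x :=
    fun i x hx => lt_of_ringOrbital_ne_zero hx
  have hχ : ∀ i x, φ.toFun i x ≠ 0 → χ x = 1 := by
    intro i x hx
    refine χ.one_of_mem_closedBall ?_
    rw [mem_closedBall_zero_iff]
    exact norm_le_of_ringOrbital_ne_zero hSpos i.2 hx
  set A := fluxPotential m χ with hA
  have hAmem : A ∈ vectorPotentials := fluxPotential_mem m χ.contDiff χ.hasCompactSupport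
  have hKi : 2⁻¹ * ∑ i, ∑ a, ∫⁻ x, ENNReal.ofReal ((fderiv ℝ (φ.toFun i) x (axis a)) ^ 2) = X := by
    have h1 : ∀ (i : Fin (n + 1)) a,
        ∫⁻ x, ENNReal.ofReal ((fderiv ℝ (φ.toFun i) x (axis a)) ^ 2) =
        c * ∫⁻ x, ENNReal.ofReal ((fderiv ℝ (ringProfile m) x (axis a)) ^ 2) := by
      intro i a
      have h2 : ∀ x, ENNReal.ofReal ((fderiv ℝ (φ.toFun i) x (axis a)) ^ 2) = _ := fun x =>
        fderiv_ringOrbital m (d + 8) i x (axis a)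
      simp_rw [h2]
      rw [lintegral_const_mul' _ _ hct, lintegral_sub_right_eq_self
        (fun x => ENNReal.ofReal ((fderiv ℝ (ringProfile m) x (axis a)) ^ 2))]
    simp_rw [h1, ← Finset.mul_sum]
    rw [Finset.sum_const, Finset.card_univ, Fintype.card_fin, nsmul_eq_mul, mul_left_comm c]
  have hMi : ∫⁻ x, (ENNReal.ofReal (axisDistSq x))⁻¹ * ENNReal.ofReal (φ.rho x) =
      ((n + 1 : ℕ) : ℝ≥0∞) * (c * M) := by
    have hmeas : ∀ i, Measurable (fun x =>
        (ENNReal.ofReal (axisDistSq x))⁻¹ * ENNReal.ofReal (φ.toFun i x ^ 2)) := fun i =>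
      contDiff_axisDistSq.continuous.measurable.ennreal_ofReal.inv.mul
        ((φ.contDiff i).continuous.pow 2).measurable.ennreal_ofReal
    have h1 : ∀ i : Fin (n + 1), ∫⁻ x, (ENNReal.ofReal (axisDistSq x))⁻¹ *
        ENNReal.ofReal (φ.toFun i x ^ 2) = c * M := by
      intro i
      have h2 : ∀ x, (ENNReal.ofReal (axisDistSq x))⁻¹ * ENNReal.ofReal (φ.toFun i x ^ 2) =
          c * ((ENNReal.ofReal (axisDistSq (x - ((i : ℝ) * (d + 8)) • axis 2)))⁻¹ *
            ENNReal.ofReal (ringProfile m (x - ((i : ℝ) * (d + 8)) • axis 2) ^ 2)) := by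
        intro x
        rw [axisDistSq_sub, mul_left_comm]
        congr 1
        exact sq_ringOrbital m (d + 8) i x
      simp_rw [h2]
      rw [lintegral_const_mul' _ _ hct, lintegral_sub_right_eq_self
        (fun x => (ENNReal.ofReal (axisDistSq x))⁻¹ * ENNReal.ofReal (ringProfile m x ^ 2))]
    simp_rw [RealOrbitals.ofReal_rho, Finset.mul_sum]
    rw [lintegral_finsetSum _ fun i _ => hmeas i]
    simp_rw [h1]
    rw [Finset.sum_const, Finset.card_univ, Fintype.card_fin, nsmul_eq_mul]
  refine ⟨φ.rho, φ.isDensity_rho, fun A hA => φ.GPure_rho_lt_top hq hdpos hsep hA.1.continuous,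
    A, hAmem, X + ε, ?_, ?_, ?_⟩
  -- No potential: the undressed determinant is the trial state.
  · refine (φ.GPure_rho_le (w := fun _ => 1) contDiff_const hq (fun _ _ _ => norm_one) hdpos hsep
      continuous_zero).trans (le_of_eq ?_)
    rw [hrep, ← hKi]
    congr 3 with i
    refine Finset.sum_congr rfl fun a _ => lintegral_congr fun x => ?_
    exact φ.covDeriv_dress _ _ (by simp) i a x
  -- One flux quantum: the phase gauges `A` away, and the kinetic energy is again `X`.
  · refine (φ.GPure_rho_le (contDiff_phase m) hq (fun i x hx => norm_phase (hs i x hx).le) hdpos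
      hsep hAmem.1.continuous).trans (le_of_eq ?_)
    rw [hrep, ← hKi]
    congr 3 with i
    refine Finset.sum_congr rfl fun a _ => lintegral_congr fun x => ?_
    exact φ.covDeriv_dress _ _ (fun i x hx a => fderiv_phase (hs i x hx) (hχ i x hx) a) i a x
  -- Half a flux quantum: `Y` is the Hardy lower bound for this density.
  · refine hXε.trans_le ?_
    rw [hY, ← hMi]
    have hρc : Continuous φ.rho := continuous_finsetSum _ fun i _ => (φ.contDiff i).continuous.pow 2
    refine lintegral_inv_axisDistSq_le_G q n (S := {x | φ.rho x ≠ 0})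
      (isOpen_ne_fun hρc continuous_const).measurableSet (fun x hx => not_not.1 hx)
      (hAmem.1.continuous.const_smul _) fun x hx => ?_
    obtain ⟨i, -, hi⟩ := Finset.exists_ne_zero_of_sum_ne_zero hx
    have hi' : φ.toFun i x ≠ 0 := fun h => hi (by simp [h])
    have hrot := fluxPotential_rot (hs i x hi').le (hχ i x hi')
    simp only [Pi.smul_apply, PiLp.smul_apply, smul_eq_mul]
    linear_combination (1 / 2 : ℝ) * hrot

end GrayceHarris

end

theorem proposition1 (q n : ℕ) (hq : 1 ≤ q) :
    ∃ ρ : GrayceHarris.Space → ℝ, GrayceHarris.IsDensity (n + 1) ρ ∧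
      -- the mixed-state functional
      (∀ A ∈ GrayceHarris.vectorPotentials, GrayceHarris.G q n ρ A < ⊤) ∧
      ¬ ConvexOn ℝ GrayceHarris.vectorPotentials (fun A => (GrayceHarris.G q n ρ A).toReal) ∧
      -- the pure-state functional
      (∀ A ∈ GrayceHarris.vectorPotentials, GrayceHarris.GPure q n ρ A < ⊤) ∧
      ¬ ConvexOn ℝ GrayceHarris.vectorPotentials (fun A => (GrayceHarris.GPure q n ρ A).toReal) := by
  obtain ⟨ρ, hρ, hfin, A, hA, U, h0, h1, hm⟩ := GrayceHarris.exists_density_flux_barrier q n hq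
  have hz : (0 : GrayceHarris.Space → GrayceHarris.Space) ∈ GrayceHarris.vectorPotentials :=
    ⟨contDiff_const, HasCompactSupport.zero⟩
  have hh : (1 / 2 : ℝ) • A ∈ GrayceHarris.vectorPotentials :=
    ⟨ContDiff.const_smul (1 / 2 : ℝ) hA.1, hA.2.smul_left (f := fun _ => (1 / 2 : ℝ))⟩
  have hle := GrayceHarris.G_le_GPure q n ρ
  refine ⟨ρ, hρ, fun B hB => (hle B).trans_lt (hfin B hB), ?_, hfin, ?_⟩
  -- The upper bounds at the endpoints are proved for pure states and the lower bound at the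
  -- midpoint for mixed ones. Since `G ≤ GPure`, each bound transfers in the direction needed, and
  -- the same `ρ` serves both functionals.
  · exact GrayceHarris.not_convexOn_of_midpoint hz hA ((hle _).trans h0) ((hle _).trans h1) hm
      ((hle _).trans_lt (hfin _ hh)).ne
  · exact GrayceHarris.not_convexOn_of_midpoint hz hA h0 h1 (hm.trans_le (hle _)) (hfin _ hh).ne
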